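/- **Setting.** Let $(\Omega,\mathcal F,P)$ be a probability space, let $Z$ be a square integrable random vector in $\mathbb R^{q}$ (noisy image) and $\hat A$ a square integrable random $q\times p$ matrix (pilot estimate of an operator). Let $\mu>0$, let $G\in\mathbb R^{p\times p}$ and $\mathcal K\in\mathbb R^{pq\times pq}$, and write $G^2=G^\top G$, $\mathcal K^2=\mathcal K^\top\mathcal K$, $\|A\|_{\mathcal K}=\|\mathcal K\,\mathrm{vec}A\|$. For $\upsilon=(\theta,z,A)\in\mathbb R^{p}\times\mathbb R^{q}\times\mathbb R^{q\times p}$ (with the Euclidean norm) put $$L(\upsilon)=-\tfrac12\|Z-z\|^2-\tfrac{\mu^2}{2}\|A-\hat A\|_{\mathrm{Fr}}^2-\tfrac12\|z-A\theta\|^2,\qquad L_{\mathcal G}(\upsilon)=L(\upsilon)-\tfrac12\|G\theta\|^2-\tfrac12\|A\|_{\mathcal K}^2 .$$ Let $\upsilon^*=(\theta^*,z^*,A^*)$ be a maximizer of $f(\upsilon)=\mathbb E L(\upsilon)$, let $\upsilon^*_{\mathcal G}$ be a maximizer of $\mathbb E L_{\mathcal G}$, and let $\tilde\upsilon_{\mathcal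 G}=(\tilde\theta_{\mathcal G},\tilde z_{\mathcal G},\tilde A_{\mathcal G})$ be a (measurable) maximizer of $L_{\mathcal G}$, all over the full parameter space. Put $\mathcal G^2=\mathrm{block}\{G^2,0,\mathcal K^2\}$, $\mathbb F_{\mathcal G}=-\nabla^2 f(\upsilon^*_{\mathcal G})+\mathcal G^2$, $\zeta=L-\mathbb EL$ (its gradient $\nabla\zeta$ does not depend on $\upsilon$), and $T(u)=\frac16\langle\nabla^3f(\upsilon^*_{\mathcal G}),u^{\otimes3}\rangle$. Define $$\phi_{\mathcal G}=\mathbb F_{\mathcal G}^{-1}\{\nabla\zeta+\nabla T(\mathbb F_{\mathcal G}^{-1}\nabla\zeta)\},\qquad \mu_{\mathcal G}=\mathbb F_{\mathcal G}^{-1}\{\mathcal G^2\upsilon^*+\nabla T(\mathbb F_{\mathcal G}^{-1}\mathcal G^2\upsilon^*)\};$$ the subscript $\theta$ (as in $\phi_{\mathcal G,\theta}$) denotes the $\theta$-component. **Conditions.** Let $D$ be a symmetric positive definite $p\times p$ matrix with $$A^{*\top}A^*\le D^2\le A^{*\top}A^*+G^2 ,$$ $N=\lambda_{\min}(D^2)$,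 $0<\delta_0\le 1/10$, $R=\delta_0\mu\sqrt N$, $\mathcal D=\mathrm{block}\{D,I,\mu I\}$, and $$\Upsilon^\circ=\{(\theta,z,A):\|D\theta\|\le R,\ \|z\|\le R,\ \|(A-A^*)D^{-1}\|_{\mathrm{Fr}}\le\delta_0\}.$$ Put $\varkappa=2$, $\tau_3=4.5\,N^{-1/2}\mu^{-1}$, $\tau_4=3N^{-1}\mu^{-2}$, $B_{\mathcal D}=\mathrm{Var}(\mathcal D\mathbb F_{\mathcal G}^{-1}\nabla\zeta)$, $\bar p_{\mathcal D}=\operatorname{tr}B_{\mathcal D}$, $\mathsf b_{\mathcal D}=\|\mathcal D\mathbb F_{\mathcal G}^{-1}\mathcal G^2\upsilon^*\|$, and, for some $x>0$, $r_{\mathcal D}=z(B_{\mathcal D},x)$, where $z^2(B,x)=\operatorname{tr}B+2\sqrt{x\operatorname{tr}B^2}+2x\|B\|$. Let $\Omega(x)$ be an event with $P(\Omega(x))\ge1-3e^{-x}$ on which $\|\mathcal D\mathbb F_{\mathcal G}^{-1}\nabla\zeta\|\le r_{\mathcal D}$. Suppose that $\upsilon^*,\upsilon^*_{\mathcal G}\in\Upsilon^\circ$,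 that $\tilde\upsilon_{\mathcal G}\in\Upsilon^\circ$ on $\Omega(x)$, that $$R\ge\tfrac32(r_{\mathcal D}\vee\mathsf b_{\mathcal D}),\qquad \varkappa^2\tau_3(r_{\mathcal D}\vee\mathsf b_{\mathcal D})<\tfrac49,\qquad \varkappa^2\tau_4(r_{\mathcal D}\vee\mathsf b_{\mathcal D})^2<\tfrac13,$$ and that with constants $C_3,C_4,C_6\ge0$ $$\mathbb E\{\|\mathcal D\mathbb F_{\mathcal G}^{-1}\nabla\zeta\|^k\mathbf 1_{\Omega(x)}\}\le C_k^2\,\bar p_{\mathcal D}^{\,k/2},\qquad k=3,4,6.$$ **Theorem.** Let $Q:\mathbb R^p\to\mathbb R^m$ be linear and put $$R_{Q,2}=\mathbb E\{\|Q(\phi_{\mathcal G,\theta}-\mu_{\mathcal G,\theta})\|^2\mathbf 1_{\Omega(x)}\},\qquad R_Q=\mathbb E\{\|Q(\mathbb F_{\mathcal G}^{-1}\nabla\zeta-\mathbb F_{\mathcal G}^{-1}\mathcal G^2\upsilon^*)_\theta\|^2\mathbf 1_{\Omega(x)}\}.$$ Then $R_{Q,2}$, $R_Q$ and $\mathbb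 E\{\|Q(\tilde\theta_{\mathcal G}-\theta^*)\|^2\mathbf 1_{\Omega(x)}\}$ are finite, and the following hold. 1. $\displaystyle \mathbb E\{\|Q(\tilde\theta_{\mathcal G}-\theta^*)\|\mathbf 1_{\Omega(x)}\}\le\mathbb E\{\|Q(\phi_{\mathcal G,\theta}-\mu_{\mathcal G,\theta})\|\mathbf 1_{\Omega(x)}\}+\|QD^{-1}\|\,\varkappa^2\Bigl(\frac{\tau_4}2+\varkappa^2\tau_3^2\Bigr)\bigl(C_3^2\,\bar p_{\mathcal D}^{3/2}+\mathsf b_{\mathcal D}^3\bigr).$ 2. $\displaystyle \Bigl|\mathbb E\{\|Q(\phi_{\mathcal G,\theta}-\mu_{\mathcal G,\theta})\|\mathbf 1_{\Omega(x)}\}-\mathbb E\{\|Q(\mathbb F_{\mathcal G}^{-1}\nabla\zeta-\mathbb F_{\mathcal G}^{-1}\mathcal G^2\upsilon^*)_\theta\|\mathbf 1_{\Omega(x)}\}\Bigr|\le\|QD^{-1}\|\,\frac{\varkappa^2\tau_3}2\bigl(\bar p_{\mathcal D}+\mathsf b_{\mathcal D}^2\bigr).$ 3. If $R_{Q,2}>0$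 and $$\alpha_{Q,2}=\frac{\|QD^{-1}\|\,\varkappa^2(\tau_4/2+\varkappa^2\tau_3^2)\bigl(C_6\,\bar p_{\mathcal D}^{3/2}+\mathsf b_{\mathcal D}^3\bigr)}{\sqrt{R_{Q,2}}}<1,$$ then $(1-\alpha_{Q,2})^2R_{Q,2}\le\mathbb E\{\|Q(\tilde\theta_{\mathcal G}-\theta^*)\|^2\mathbf 1_{\Omega(x)}\}\le(1+\alpha_{Q,2})^2R_{Q,2}.$ 4. If $\alpha_{Q,1}<1$ satisfies $\|QD^{-1}\|\,\frac{\varkappa^2\tau_3}{2}\bigl(C_4\,\bar p_{\mathcal D}+\mathsf b_{\mathcal D}^2\bigr)\le\alpha_{Q,1}\sqrt{R_Q}$, then $R_Q(1-\alpha_{Q,1})^2\le R_{Q,2}\le R_Q(1+\alpha_{Q,1})^2.$ -/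

import Mathlib

open MeasureTheory ProbabilityTheory

noncomputable section

namespace EiO

/-- The full parameter space: a point is a triple (source, image, operator), i.e. a vector of
dimension `p + q + p * q`, with the Euclidean norm. -/
abbrev Param (p q : ℕ) : Type := EuclideanSpace ℝ (Fin p ⊕ (Fin q ⊕ (Fin q × Fin p)))

/-- The target component (source signal). -/
def src {p q : ℕ} (u : Param p q) : EuclideanSpace ℝ (Fin p) :=
  WithLp.toLp 2 (fun j => u (Sum.inl j))

/-- The image component. -/
def img {p q : ℕ} (u : Param p q) : EuclideanSpace ℝ (Fin q) :=
  WithLp.toLp 2 (fun m => u (Sum.inr (Sum.inl m)))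

/-- The operator component, as a `q × p` matrix. -/
def opr {p q : ℕ} (u : Param p q) : Matrix (Fin q) (Fin p) ℝ :=
  fun m j => u (Sum.inr (Sum.inr (m, j)))

/-- The Frobenius norm of a matrix. -/
def frob {p q : ℕ} (A : Matrix (Fin q) (Fin p) ℝ) : ℝ :=
  Real.sqrt (∑ m, ∑ j, A m j ^ 2)

/-- The entries of a matrix as a Euclidean vector. -/
def vec {p q : ℕ} (A : Matrix (Fin q) (Fin p) ℝ) : EuclideanSpace ℝ (Fin q × Fin p) :=
  WithLp.toLp 2 (fun i => A i.1 i.2)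

/-- The data of an error-in-operator model: the noisy image `Z`, the pilot operator estimate
`Ahat`, the operator noise factor `mu`, and the penalties `‖G θ‖² / 2` and `‖K vec A‖² / 2`.
A diagonal `K` gives the elementwise operator penalty `∑ k m j * (A m j) ^ 2`. -/
structure Model (Ω : Type*) (p q : ℕ) where
  Z : Ω → EuclideanSpace ℝ (Fin q)
  Ahat : Ω → Matrix (Fin q) (Fin p) ℝ
  mu : ℝ
  G : Matrix (Fin p) (Fin p) ℝ
  K : Matrix (Fin q × Fin p) (Fin q × Fin p) ℝ

variable {Ω : Type*} {p q : ℕ}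

/-- The log-likelihood `L(u)`. -/
def logLik (M : Model Ω p q) (ω : Ω) (u : Param p q) : ℝ :=
  -(1 / 2) * ‖M.Z ω - img u‖ ^ 2 - M.mu ^ 2 / 2 * frob (opr u - M.Ahat ω) ^ 2
    - 1 / 2 * ‖img u - Matrix.toEuclideanLin (opr u) (src u)‖ ^ 2

/-- The penalized log-likelihood `L_G(u)`. -/
def penLogLik (M : Model Ω p q) (ω : Ω) (u : Param p q) : ℝ :=
  logLik M ω u - 1 / 2 * ‖Matrix.toEuclideanLin M.G (src u)‖ ^ 2
    - 1 / 2 * ‖Matrix.toEuclideanLin M.K (vec (opr u))‖ ^ 2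

/-- `f(u) = E L(u)`. -/
def meanLogLik [MeasurableSpace Ω] (P : Measure Ω) (M : Model Ω p q) (u : Param p q) : ℝ :=
  ∫ ω, logLik M ω u ∂P

/-- `E L_G(u)`. -/
def meanPenLogLik [MeasurableSpace Ω] (P : Measure Ω) (M : Model Ω p q) (u : Param p q) : ℝ :=
  ∫ ω, penLogLik M ω u ∂P

/-- The full-dimensional information matrix `F(u) = - ∇² E L(u)`. -/
def info [MeasurableSpace Ω] (P : Measure Ω) (M : Model Ω p q) (u : Param p q) :
    Matrix (Fin p ⊕ (Fin q ⊕ (Fin q × Fin p))) (Fin p ⊕ (Fin q ⊕ (Fin q × Fin p))) ℝ :=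
  fun i j => -iteratedFDeriv ℝ 2 (meanLogLik P M) u
    ![EuclideanSpace.single i 1, EuclideanSpace.single j 1]

/-- The penalty matrix `block{G², 0, K²}`. -/
def penMat (M : Model Ω p q) :
    Matrix (Fin p ⊕ (Fin q ⊕ (Fin q × Fin p))) (Fin p ⊕ (Fin q ⊕ (Fin q × Fin p))) ℝ :=
  Matrix.fromBlocks (M.G.transpose * M.G) 0 0
    (Matrix.fromBlocks 0 0 0 (M.K.transpose * M.K))

/-- The penalized information matrix `F_G(u) = F(u) + block{G², 0, K²}`. -/
def penInfo [MeasurableSpace Ω] (P : Measure Ω) (M : Model Ω p q) (u : Param p q) :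
    Matrix (Fin p ⊕ (Fin q ⊕ (Fin q × Fin p))) (Fin p ⊕ (Fin q ⊕ (Fin q × Fin p))) ℝ :=
  info P M u + penMat M

/-- The vector `F_G(u)⁻¹ v`. -/
def invInfo [MeasurableSpace Ω] (P : Measure Ω) (M : Model Ω p q) (u v : Param p q) : Param p q :=
  Matrix.toEuclideanLin (penInfo P M u)⁻¹ v

/-- The metric tensor `block{D, I, μ I}`. -/
def metric (M : Model Ω p q) (D : Matrix (Fin p) (Fin p) ℝ) :
    Matrix (Fin p ⊕ (Fin q ⊕ (Fin q × Fin p))) (Fin p ⊕ (Fin q ⊕ (Fin q × Fin p))) ℝ :=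
  Matrix.fromBlocks D 0 0
    (Matrix.fromBlocks (1 : Matrix (Fin q) (Fin q) ℝ) 0 0
      (M.mu • (1 : Matrix (Fin q × Fin p) (Fin q × Fin p) ℝ)))

/-- The score `∇ζ(u)`, `ζ = L - E L`. -/
def score [MeasurableSpace Ω] (P : Measure Ω) (M : Model Ω p q) (u : Param p q) (ω : Ω) :
    Param p q :=
  gradient (fun v => logLik M ω v - meanLogLik P M v) u

/-- The third-order tensor `T(v) = ⟨∇³ E L(u), v ⊗ v ⊗ v⟩ / 6` at the base point `u`. -/
def tensor [MeasurableSpace Ω] (P : Measure Ω) (M : Model Ω p q) (u v : Param p q) : ℝ :=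
  1 / 6 * iteratedFDeriv ℝ 3 (meanLogLik P M) u (fun _ => v)

/-- The vector `F_G⁻¹ ∇ζ`, with `F_G` and `∇ζ` taken at `u`. -/
def stoch [MeasurableSpace Ω] (P : Measure Ω) (M : Model Ω p q) (u : Param p q) (ω : Ω) :
    Param p q :=
  invInfo P M u (score P M u ω)

/-- The vector `F_G⁻¹ block{G², 0, K²} us`, with `F_G` taken at `u`. -/
def bias [MeasurableSpace Ω] (P : Measure Ω) (M : Model Ω p q) (u us : Param p q) : Param p q :=
  invInfo P M u (Matrix.toEuclideanLin (penMat M) us)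

/-- `φ_G = F_G⁻¹ {∇ζ + ∇T(F_G⁻¹ ∇ζ)}`. -/
def phi [MeasurableSpace Ω] (P : Measure Ω) (M : Model Ω p q) (u : Param p q) (ω : Ω) :
    Param p q :=
  invInfo P M u (score P M u ω + gradient (tensor P M u) (stoch P M u ω))

/-- `μ_G = F_G⁻¹ {block{G², 0, K²} us + ∇T(F_G⁻¹ block{G², 0, K²} us)}`. -/
def muVec [MeasurableSpace Ω] (P : Measure Ω) (M : Model Ω p q) (u us : Param p q) : Param p q :=
  invInfo P M u
    (Matrix.toEuclideanLin (penMat M) us + gradient (tensor P M u) (bias P M u us))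

/-- The vector whose norm is `‖𝒟 F_G⁻¹ ∇ζ‖`. -/
def normStoch [MeasurableSpace Ω] (P : Measure Ω) (M : Model Ω p q)
    (D : Matrix (Fin p) (Fin p) ℝ) (u : Param p q) (ω : Ω) : Param p q :=
  Matrix.toEuclideanLin (metric M D) (stoch P M u ω)

/-- The covariance matrix of a random vector. -/
def varMat [MeasurableSpace Ω] {ι : Type*} (P : Measure Ω) (X : Ω → EuclideanSpace ℝ ι) :
    Matrix ι ι ℝ :=
  fun i j => covariance (fun ω => X ω i) (fun ω => X ω j) P

/-- The quantile `z(B, x)`, with `z² = tr B + 2 √(x tr B²) + 2 x ‖B‖`. -/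
def zq {ι : Type*} [Fintype ι] [DecidableEq ι] (B : Matrix ι ι ℝ) (x : ℝ) : ℝ :=
  Real.sqrt (B.trace + 2 * Real.sqrt (x * (B * B).trace)
    + 2 * x * ‖Matrix.toEuclideanCLM (𝕜 := ℝ) B‖)

/-- The effective dimension `tr Var(𝒟 F_G⁻¹ ∇ζ)`. -/
def effDim [MeasurableSpace Ω] (P : Measure Ω) (M : Model Ω p q)
    (D : Matrix (Fin p) (Fin p) ℝ) (u : Param p q) : ℝ :=
  (varMat P (normStoch P M D u)).trace

/-- The radius `r_D = z(Var(𝒟 F_G⁻¹ ∇ζ), x)`. -/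
def rD [MeasurableSpace Ω] (P : Measure Ω) (M : Model Ω p q)
    (D : Matrix (Fin p) (Fin p) ℝ) (u : Param p q) (x : ℝ) : ℝ :=
  zq (varMat P (normStoch P M D u)) x

/-- The bias `b_D = ‖𝒟 F_G⁻¹ block{G², 0, K²} us‖`. -/
def bD [MeasurableSpace Ω] (P : Measure Ω) (M : Model Ω p q)
    (D : Matrix (Fin p) (Fin p) ℝ) (u us : Param p q) : ℝ :=
  ‖Matrix.toEuclideanLin (metric M D) (bias P M u us)‖

/-- The effective sample size `N = λ_min(D²)`. -/
def effN (D : Matrix (Fin p) (Fin p) ℝ) : ℝ := sInf (spectrum ℝ (D * D))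

/-- The radius `R = δ₀ μ √N`. -/
def radius (M : Model Ω p q) (D : Matrix (Fin p) (Fin p) ℝ) (δ₀ : ℝ) : ℝ :=
  δ₀ * M.mu * Real.sqrt (effN D)

/-- The local set around the true operator `As`. -/
def localSet (M : Model Ω p q) (D : Matrix (Fin p) (Fin p) ℝ) (δ₀ : ℝ)
    (As : Matrix (Fin q) (Fin p) ℝ) : Set (Param p q) :=
  {u | ‖Matrix.toEuclideanLin D (src u)‖ ≤ radius M D δ₀ ∧ ‖img u‖ ≤ radius M D δ₀ ∧
    frob ((opr u - As) * D⁻¹) ≤ δ₀}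

/-- `τ₃ = 4.5 N^{-1/2} μ⁻¹`. -/
def tau3 (M : Model Ω p q) (D : Matrix (Fin p) (Fin p) ℝ) : ℝ :=
  9 / 2 / (Real.sqrt (effN D) * M.mu)

/-- `τ₄ = 3 N⁻¹ μ⁻²`. -/
def tau4 (M : Model Ω p q) (D : Matrix (Fin p) (Fin p) ℝ) : ℝ :=
  3 / (effN D * M.mu ^ 2)

/-- The constant `ϰ = 2`. -/
def kap : ℝ := 2

/-- The norm `‖Q D⁻¹‖`. -/
def normQD {m : ℕ} (Q : EuclideanSpace ℝ (Fin p) →L[ℝ] EuclideanSpace ℝ (Fin m))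
    (D : Matrix (Fin p) (Fin p) ℝ) : ℝ :=
  ‖Q.comp (Matrix.toEuclideanCLM (𝕜 := ℝ) D⁻¹)‖

/-- `R_Q = E {‖Q (F_G⁻¹ ∇ζ)_θ - Q (F_G⁻¹ block{G², 0, K²} us)_θ‖² 1(Ωx)}`. -/
def riskQ [MeasurableSpace Ω] {m : ℕ} (P : Measure Ω) (M : Model Ω p q)
    (Q : EuclideanSpace ℝ (Fin p) →L[ℝ] EuclideanSpace ℝ (Fin m)) (u us : Param p q)
    (Ωx : Set Ω) : ℝ :=
  ∫ ω in Ωx, ‖Q (src (stoch P M u ω)) - Q (src (bias P M u us))‖ ^ 2 ∂P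

/-- `R_{Q,2} = E {‖Q (φ_{G,θ} - μ_{G,θ})‖² 1(Ωx)}`. -/
def riskQ2 [MeasurableSpace Ω] {m : ℕ} (P : Measure Ω) (M : Model Ω p q)
    (Q : EuclideanSpace ℝ (Fin p) →L[ℝ] EuclideanSpace ℝ (Fin m)) (u us : Param p q)
    (Ωx : Set Ω) : ℝ :=
  ∫ ω in Ωx, ‖Q (src (phi P M u ω) - src (muVec P M u us))‖ ^ 2 ∂P

/-- `α_{Q,2} = ‖Q D⁻¹‖ ϰ² (τ₄ / 2 + ϰ² τ₃²) (C₆ p_D^{3/2} + b_D³) / √R_{Q,2}`. -/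
def alphaQ2 [MeasurableSpace Ω] {m : ℕ} (P : Measure Ω) (M : Model Ω p q)
    (D : Matrix (Fin p) (Fin p) ℝ)
    (Q : EuclideanSpace ℝ (Fin p) →L[ℝ] EuclideanSpace ℝ (Fin m)) (u us : Param p q)
    (Ωx : Set Ω) (C₆ : ℝ) : ℝ :=
  normQD Q D * kap ^ 2 * (tau4 M D / 2 + kap ^ 2 * tau3 M D ^ 2)
    * (C₆ * effDim P M D u ^ (3 / 2 : ℝ) + bD P M D u us ^ 3)
    / Real.sqrt (riskQ2 P M Q u us Ωx)

end EiO

end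

/-!
The expected log-likelihood is, up to a constant, the log-likelihood at the mean of the data, and
both are quartic polynomials `c - ½‖h - π u‖² - ½‖a - σ u‖² - ½‖π u - β(u, u)‖²` of the parameter
`u = (θ, z, A)`, where `β(u, u) = A θ`. All derivatives are explicit and the Taylor expansion
stops at the fourth order.

* The score is affine in the data, centred, and independent of the parameter (`score_eq`). Hence
  the estimator and the truth are critical points of the same function, the penalized expected
  log-likelihood, up to a linear term `⟨A, ·⟩`: with `A = ∇ζ` for the estimator and `A = 𝒢² υ*` for
  the truth.
* On the local set the penalized information dominates `𝒟² / 4`. Because of `D² ≤ A*ᵀ A* + G²`, the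
  source direction is controlled through `A*` and the penalty; the only negative term of the
  information is proportional to the small residual `z - A θ` and is absorbed. On a slightly larger
  region, which also contains the points `υ*_𝒢 + F⁻¹ A`, the bound is still `𝒟² / 5`
  (`coercive_quarticHess`).
* Strong concavity between `υ*_𝒢 + F⁻¹ A` and a critical point `y` localizes `y` at distance
  `O(‖𝒟 F⁻¹ A‖²)` from `υ*_𝒢 + F⁻¹ A`; one more use of the exact expansion gives
  `y = υ*_𝒢 + F⁻¹ {A + ∇T(F⁻¹ A)}` up to `ϰ² (τ₄ / 2 + ϰ² τ₃²) ‖𝒟 F⁻¹ A‖³`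
  (`norm_sub_expansion_le`, `norm_expansion_le`).
* Subtracting the two expansions compares the loss with `φ_𝒢 - μ_𝒢` pointwise on the random set,
  and bounding the corrections `F⁻¹ ∇T` compares the latter with its linear part. The bounds in
  mean follow by integration, those on squared risks from Minkowski's inequality
  (`abs_integral_norm_sub_le`, `abs_sqrt_integral_sub_le`).
-/

/-! ### Calculus of the quartic polynomial -/

namespace EiO

section Quartic

open scoped RealInnerProductSpace

variable {E H K : Type*} [NormedAddCommGroup E] [InnerProductSpace ℝ E]
  [NormedAddCommGroup H] [InnerProductSpace ℝ H] [NormedAddCommGroup K] [InnerProductSpace ℝ K]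

/-- The quartic polynomial `c - ½‖h - π u‖² - ½‖a - σ u‖² - ½‖π u - β(u, u)‖²`, the shape shared by
the log-likelihood and its expectation. -/
noncomputable def quartic (π : E →L[ℝ] H) (σ : E →L[ℝ] K) (β : E →L[ℝ] E →L[ℝ] H) (h : H) (a : K)
    (c : ℝ) (u : E) : ℝ :=
  c - 1 / 2 * ‖h - π u‖ ^ 2 - 1 / 2 * ‖a - σ u‖ ^ 2 - 1 / 2 * ‖π u - β u u‖ ^ 2

/-- The derivative of `quartic` at `u` in the direction `v`. -/
noncomputable def quarticDeriv (π : E →L[ℝ] H) (σ : E →L[ℝ] K) (β : E →L[ℝ] E →L[ℝ] H) (h : H)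
    (a : K) (u v : E) : ℝ :=
  ⟪h - π u, π v⟫ + ⟪a - σ u, σ v⟫ - ⟪π u - β u u, π v - (2 : ℝ) • β u v⟫

/-- Minus the second derivative of `quartic` at `u` in the directions `v`, `w`. -/
noncomputable def quarticHess (π : E →L[ℝ] H) (σ : E →L[ℝ] K) (β : E →L[ℝ] E →L[ℝ] H)
    (u v w : E) : ℝ :=
  ⟪π v, π w⟫ + ⟪σ v, σ w⟫ + ⟪π v - (2 : ℝ) • β u v, π w - (2 : ℝ) • β u w⟫
    - 2 * ⟪π u - β u u, β v w⟫

/-- Half the third derivative of `quartic` at `u`, a symmetric trilinear form. -/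
noncomputable def quarticThird (π : E →L[ℝ] H) (β : E →L[ℝ] E →L[ℝ] H) (u a b c : E) : ℝ :=
  ⟪π a - (2 : ℝ) • β u a, β b c⟫ + ⟪π b - (2 : ℝ) • β u b, β a c⟫
    + ⟪π c - (2 : ℝ) • β u c, β a b⟫

variable {π : E →L[ℝ] H} {σ : E →L[ℝ] K} {β : E →L[ℝ] E →L[ℝ] H} {h : H} {a : K} {c : ℝ}

lemma contDiff_quartic {n : WithTop ℕ∞} : ContDiff ℝ n (quartic π σ β h a c) := by
  unfold quartic
  have h1 : ContDiff ℝ n (fun u => β u u) := β.contDiff.clm_apply contDiff_id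
  exact ((contDiff_const.sub (contDiff_const.mul ((contDiff_const.sub π.contDiff).norm_sq ℝ))).sub
    (contDiff_const.mul ((contDiff_const.sub σ.contDiff).norm_sq ℝ))).sub
    (contDiff_const.mul ((π.contDiff.sub h1).norm_sq ℝ))

/-- The first-order coefficient of a polynomial along a line is the directional derivative. -/
lemma fderiv_apply_of_line {f : E → ℝ} {x v : E} (hf : DifferentiableAt ℝ f x) (a₁ a₂ a₃ a₄ : ℝ)
    (hl : ∀ t : ℝ, f (x + t • v) = f x + t * a₁ + t ^ 2 * a₂ + t ^ 3 * a₃ + t ^ 4 * a₄) :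
    fderiv ℝ f x v = a₁ := by
  rw [← hf.lineDeriv_eq_fderiv, lineDeriv, funext hl]
  have := (((((hasDerivAt_id (0 : ℝ)).mul_const a₁).const_add (f x)).add
    (((hasDerivAt_id (0 : ℝ)).pow 2).mul_const a₂)).add
    (((hasDerivAt_id (0 : ℝ)).pow 3).mul_const a₃)).add
    (((hasDerivAt_id (0 : ℝ)).pow 4).mul_const a₄)
  simpa using! this.deriv

lemma quarticThird_self (u v : E) :
    quarticThird π β u v v v = 3 * ⟪π v - (2 : ℝ) • β u v, β v v⟫ := by
  unfold quarticThird; ring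

lemma quartic_line (hβ : ∀ u v, β u v = β v u) (u v : E) (t : ℝ) :
    quartic π σ β h a c (u + t • v) = quartic π σ β h a c u + t * quarticDeriv π σ β h a u v
      + t ^ 2 * (-(1 / 2) * quarticHess π σ β u v v)
      + t ^ 3 * (1 / 3 * quarticThird π β u v v v) + t ^ 4 * (-(1 / 2) * ‖β v v‖ ^ 2) := by
  have e1 : h - π (u + t • v) = (h - π u) - t • π v := by simp [sub_add_eq_sub_sub]
  have e2 : a - σ (u + t • v) = (a - σ u) - t • σ v := by simp [sub_add_eq_sub_sub]
  have e3 : π (u + t • v) - β (u + t • v) (u + t • v)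
      = (π u - β u u) + t • (π v - (2 : ℝ) • β u v) - (t ^ 2) • β v v := by
    simp only [map_add, map_smul, add_apply, smul_apply, hβ v u]
    module
  rw [quartic, quartic, quarticDeriv, quarticHess, quarticThird_self, e1, e2, e3]
  simp only [← real_inner_self_eq_norm_sq]
  generalize h - π u = x1
  generalize a - σ u = x2
  generalize π u - β u u = x3
  generalize π v - (2 : ℝ) • β u v = x4
  simp only [inner_sub_left, inner_sub_right, inner_add_left, inner_add_right,
    real_inner_smul_left, real_inner_smul_right]
  rw [real_inner_comm x1 (π v), real_inner_comm x2 (σ v), real_inner_comm x3 x4,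
    real_inner_comm x3 (β v v), real_inner_comm x4 (β v v)]
  ring

lemma quarticDeriv_add (hβ : ∀ u v, β u v = β v u) (u d v : E) :
    quarticDeriv π σ β h a (u + d) v = quarticDeriv π σ β h a u v - quarticHess π σ β u d v
      + quarticThird π β u d d v - 2 * ⟪β d d, β d v⟫ := by
  have e1 : h - π (u + d) = (h - π u) - π d := by simp [sub_add_eq_sub_sub]
  have e2 : a - σ (u + d) = (a - σ u) - σ d := by simp [sub_add_eq_sub_sub]
  have e3 : π (u + d) - β (u + d) (u + d)
      = (π u - β u u) + (π d - (2 : ℝ) • β u d) - β d d := by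
    simp only [map_add, add_apply, hβ d u]
    module
  have e4 : π v - (2 : ℝ) • β (u + d) v = (π v - (2 : ℝ) • β u v) - (2 : ℝ) • β d v := by
    simp only [map_add, add_apply]
    module
  rw [quarticDeriv, quarticDeriv, quarticHess, quarticThird, e1, e2, e3, e4]
  generalize h - π u = x1
  generalize a - σ u = x2
  generalize π u - β u u = x3
  generalize π d - (2 : ℝ) • β u d = x4
  generalize π v - (2 : ℝ) • β u v = x5
  simp only [inner_sub_left, inner_sub_right, inner_add_left, real_inner_smul_right]
  rw [real_inner_comm x5 (β d d)]
  ring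

lemma quarticHess_line (hβ : ∀ u v, β u v = β v u) (u d v : E) (t : ℝ) :
    quarticHess π σ β (u + t • d) v v = quarticHess π σ β u v v
      + t * (-2 * quarticThird π β u d v v)
      + t ^ 2 * (4 * ‖β d v‖ ^ 2 + 2 * ⟪β d d, β v v⟫) := by
  have e3 : π (u + t • d) - β (u + t • d) (u + t • d)
      = (π u - β u u) + t • (π d - (2 : ℝ) • β u d) - (t ^ 2) • β d d := by
    simp only [map_add, map_smul, add_apply, smul_apply, hβ d u]
    module
  have e4 : π v - (2 : ℝ) • β (u + t • d) v
      = (π v - (2 : ℝ) • β u v) - t • (2 : ℝ) • β d v := by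
    simp only [map_add, map_smul, add_apply, smul_apply]
    module
  rw [quarticHess, quarticHess, quarticThird, e3, e4]
  simp only [← real_inner_self_eq_norm_sq]
  generalize π u - β u u = x3
  generalize π d - (2 : ℝ) • β u d = x4
  generalize π v - (2 : ℝ) • β u v = x5
  simp only [inner_sub_left, inner_sub_right, inner_add_left,
    real_inner_smul_left, real_inner_smul_right]
  rw [real_inner_comm x5 (β d v)]
  ring

lemma fderiv_quartic_apply (hβ : ∀ u v, β u v = β v u) (u v : E) :
    fderiv ℝ (quartic π σ β h a c) u v = quarticDeriv π σ β h a u v :=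
  fderiv_apply_of_line (contDiff_quartic.differentiable one_ne_zero u) _ _ _ _
    (quartic_line hβ u v)

/-- Simpson's rule along a segment, exact since the second derivative is quadratic there. -/
lemma quarticDeriv_sub_eq_simpson (hβ : ∀ u v, β u v = β v u) (u d : E) :
    quarticDeriv π σ β h a u d - quarticDeriv π σ β h a (u + d) d
      = 1 / 6 * (quarticHess π σ β u d d + 4 * quarticHess π σ β (u + (1 / 2 : ℝ) • d) d d
        + quarticHess π σ β (u + d) d d) := by
  have h1 := quarticHess_line (π := π) (σ := σ) hβ u d d 1
  rw [one_smul] at h1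
  rw [quarticDeriv_add hβ, quarticHess_line hβ, h1, ← real_inner_self_eq_norm_sq]
  ring

lemma fderiv_fderiv_quartic_apply (hβ : ∀ u v, β u v = β v u) (u v w : E) :
    fderiv ℝ (fderiv ℝ (quartic π σ β h a c)) u v w = -quarticHess π σ β u v w := by
  have hd : Differentiable ℝ (fderiv ℝ (quartic π σ β h a c)) :=
    (contDiff_quartic.fderiv_right (m := 1) (n := 2) (by norm_num)).differentiable one_ne_zero
  have h1 : fderiv ℝ (fun y => fderiv ℝ (quartic π σ β h a c) y w) u v
      = fderiv ℝ (fderiv ℝ (quartic π σ β h a c)) u v w := by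
    rw [fderiv_clm_apply (hd u) (differentiableAt_const w)]
    simp
  rw [← h1]
  refine fderiv_apply_of_line ((hd u).clm_apply (differentiableAt_const w)) _
    (quarticThird π β u v v w) (-2 * ⟪β v v, β v w⟫) 0 fun t => ?_
  simp only [fderiv_quartic_apply hβ, quarticDeriv_add hβ]
  simp only [quarticHess, quarticThird, map_smul, smul_apply,
    real_inner_smul_left, real_inner_smul_right, ← smul_sub, smul_comm (2 : ℝ) t]
  ring

lemma iteratedFDeriv_two_quartic (hβ : ∀ u v, β u v = β v u) (u v w : E) :
    iteratedFDeriv ℝ 2 (quartic π σ β h a c) u ![v, w] = -quarticHess π σ β u v w := by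
  rw [iteratedFDeriv_two_apply]
  exact fderiv_fderiv_quartic_apply hβ u v w

lemma iteratedFDeriv_three_quartic (hβ : ∀ u v, β u v = β v u) (u v : E) :
    iteratedFDeriv ℝ 3 (quartic π σ β h a c) u (fun _ => v) = 2 * quarticThird π β u v v v := by
  have hd : Differentiable ℝ (iteratedFDeriv ℝ 2 (quartic π σ β h a c)) :=
    contDiff_quartic.differentiable_iteratedFDeriv (n := 3) (by norm_num)
  have e : ∀ y, iteratedFDeriv ℝ 2 (quartic π σ β h a c) y (fun _ => v)
      = -quarticHess π σ β y v v := fun y => by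
    rw [← iteratedFDeriv_two_quartic hβ y v v]
    congr 1
    ext i
    fin_cases i <;> rfl
  have h1 : fderiv ℝ (fun y => iteratedFDeriv ℝ 2 (quartic π σ β h a c) y (fun _ => v)) u v
      = fderiv ℝ (iteratedFDeriv ℝ 2 (quartic π σ β h a c)) u v (fun _ => v) := by
    have := ((ContinuousMultilinearMap.apply ℝ (fun _ : Fin 2 => E) ℝ
      (fun _ => v)).hasFDerivAt.comp u (hd u).hasFDerivAt).fderiv
    exact congrArg (fun L => L v) this
  rw [iteratedFDeriv_succ_apply_left]
  refine h1.symm.trans (fderiv_apply_of_line ?_ _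
    (-(4 * ‖β v v‖ ^ 2 + 2 * ⟪β v v, β v v⟫)) 0 0 fun t => ?_)
  · exact ((ContinuousMultilinearMap.apply ℝ (fun _ : Fin 2 => E) ℝ
      (fun _ => v)).hasFDerivAt.comp u (hd u).hasFDerivAt).differentiableAt
  · rw [e, e, quarticHess_line hβ]
    ring

lemma contDiff_cubic (u : E) :
    ContDiff ℝ 1 (fun v => 1 / 6 * (2 * quarticThird π β u v v v)) := by
  have h1 : ContDiff ℝ 1 (fun u => β u u) := β.contDiff.clm_apply contDiff_id
  have h2 : ContDiff ℝ 1 (fun v => ⟪π v - (2 : ℝ) • β u v, β v v⟫) :=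
    (π.contDiff.sub ((β u).contDiff.const_smul (2 : ℝ))).inner ℝ h1
  simp only [quarticThird_self]
  exact contDiff_const.mul (contDiff_const.mul (contDiff_const.mul h2))

/-- The gradient of the cubic form `v ↦ ⟨∇³ quartic(u), v ⊗ v ⊗ v⟩ / 6`. -/
lemma inner_gradient_cubic [CompleteSpace E] (hβ : ∀ u v, β u v = β v u) (u v w : E) :
    ⟪gradient (fun v => 1 / 6 * (2 * quarticThird π β u v v v)) v, w⟫
      = quarticThird π β u v v w := by
  rw [inner_gradient_left]
  refine fderiv_apply_of_line ((contDiff_cubic u).differentiable one_ne_zero v) _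
    (quarticThird π β u v w w) (1 / 3 * quarticThird π β u w w w) 0 fun t => ?_
  simp only [quarticThird, map_add, map_smul, add_apply, smul_apply,
    hβ w v, smul_add, smul_comm (2 : ℝ) t, add_sub_add_comm, ← smul_sub, inner_add_left,
    inner_add_right, real_inner_smul_left, real_inner_smul_right]
  ring

lemma continuous_gradient_cubic [CompleteSpace E] (u : E) :
    Continuous (gradient (fun v => 1 / 6 * (2 * quarticThird π β u v v v))) := by
  exact (InnerProductSpace.toDual ℝ E).symm.continuous.comp
    ((contDiff_cubic u).continuous_fderiv one_ne_zero)

lemma quarticHess_comm (hβ : ∀ u v, β u v = β v u)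
    (u v w : E) : quarticHess π σ β u v w = quarticHess π σ β u w v := by
  rw [quarticHess, quarticHess, real_inner_comm (π v), real_inner_comm (σ v), hβ v w,
    real_inner_comm (π v - _)]

/-- The first-order condition for a maximizer of a penalized quartic. -/
lemma quarticDeriv_eq_of_isMaxOn {L : E →L[ℝ] E} (hβ : ∀ u v, β u v = β v u)
    (hL : ∀ u v, ⟪L u, v⟫ = ⟪L v, u⟫) {u : E}
    (hu : IsMaxOn (fun u => quartic π σ β h a c u - 1 / 2 * ⟪L u, u⟫) Set.univ u) (v : E) :
    quarticDeriv π σ β h a u v = ⟪L u, v⟫ := by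
  have h0 := (hu.isLocalMax Filter.univ_mem).fderiv_eq_zero
  have hd : DifferentiableAt ℝ (fun u => quartic π σ β h a c u - 1 / 2 * ⟪L u, u⟫) u :=
    (contDiff_quartic.differentiable one_ne_zero u).sub
      ((L.differentiableAt.inner ℝ differentiableAt_id).const_mul _)
  have h1 := fderiv_apply_of_line hd (v := v) (quarticDeriv π σ β h a u v - ⟪L u, v⟫)
    (-(1 / 2) * quarticHess π σ β u v v - 1 / 2 * ⟪L v, v⟫)
    (1 / 3 * quarticThird π β u v v v) (-(1 / 2) * ‖β v v‖ ^ 2) fun t => by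
      simp only [quartic_line hβ, map_add, map_smul, inner_add_left, inner_add_right,
        real_inner_smul_left, real_inner_smul_right, hL v u]
      ring
  rw [h0] at h1
  simp only [zero_apply] at h1
  linarith

end Quartic

end EiO

/-! ### Expansion of a perturbed critical point -/

namespace EiO

section Perturbation

open scoped RealInnerProductSpace

variable {E H K W : Type*} [NormedAddCommGroup E] [InnerProductSpace ℝ E]
  [NormedAddCommGroup H] [InnerProductSpace ℝ H] [NormedAddCommGroup K] [InnerProductSpace ℝ K]
  [NormedAddCommGroup W] [NormedSpace ℝ W]
  {π : E →L[ℝ] H} {σ : E →L[ℝ] K} {β : E →L[ℝ] E →L[ℝ] H} {h : H} {a : K}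
  {𝒟 : E →L[ℝ] W} {F : E →L[ℝ] E} {c₀ : ℝ}

/-- A lower bound `c ‖𝒟 v‖² ≤ ⟨F v, v⟩` turns a bound on the dual norm of `F v` into one
on `‖𝒟 v‖`. -/
lemma norm_le_of_coercive {c B : ℝ} (hc : 0 < c) {v : E}
    (h1 : c * ‖𝒟 v‖ ^ 2 ≤ ⟪F v, v⟫) (h2 : ⟪F v, v⟫ ≤ B * ‖𝒟 v‖) (hB : 0 ≤ B) :
    ‖𝒟 v‖ ≤ B / c := by
  rw [le_div_iff₀ hc]
  rcases (norm_nonneg (𝒟 v)).eq_or_lt with h0 | h0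
  · rw [← h0]; simpa using hB
  · have : ‖𝒟 v‖ * (‖𝒟 v‖ * c) ≤ ‖𝒟 v‖ * B := by nlinarith
    exact le_of_mul_le_mul_left this h0

lemma quarticThird_sub_sub (hβ : ∀ u v, β u v = β v u) (u₀ u b v : E) :
    quarticThird π β u₀ u u v - quarticThird π β u₀ b b v
      = quarticThird π β u₀ (u - b) (u + b) v := by
  simp only [quarticThird, map_add, map_sub, add_apply, sub_apply, smul_add, smul_sub,
    inner_add_left, inner_add_right, inner_sub_left, inner_sub_right, hβ b u]
  ring

/-- The size of the third-order correction `F⁻¹ ∇T(b)`. -/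
lemma norm_correction_le {u₀ b φ A : E}
    (hT : ∀ u v w, |quarticThird π β u₀ u v w| ≤ 9 / 4 * c₀ * ‖𝒟 u‖ * ‖𝒟 v‖ * ‖𝒟 w‖)
    (hc : ∀ v, 1 / 4 * ‖𝒟 v‖ ^ 2 ≤ ⟪F v, v⟫) (hc₀ : 0 ≤ c₀)
    (hb : F b = A) (hφ : ∀ v, ⟪F φ, v⟫ = ⟪A, v⟫ + quarticThird π β u₀ b b v) :
    ‖𝒟 (φ - b)‖ ≤ 9 * c₀ * ‖𝒟 b‖ ^ 2 := by
  have := norm_le_of_coercive (𝒟 := 𝒟) (F := F) (c := 1 / 4) (B := 9 / 4 * c₀ * ‖𝒟 b‖ ^ 2)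
    (by norm_num) (hc (φ - b)) ?_ (by positivity)
  · linarith
  · have h1 := (abs_le.1 (hT b b (φ - b))).2
    rw [map_sub, inner_sub_left, hφ, hb]
    linarith

/-- **Third-order expansion of a perturbed maximizer.** The point `u₀` is critical for a penalized
quartic, with information `F`, and `u₀ + u` is critical for the same function plus `⟨A, ·⟩`. Then
`u` is close to `F⁻¹(A + ∇T(F⁻¹ A))`. The first bound, on `u - F⁻¹ A`, comes from the strong
concavity between `u₀ + F⁻¹ A` and `u₀ + u`, the second from the exact Taylor expansion. -/
lemma norm_sub_expansion_le {pen : E →L[ℝ] E} {u₀ u b φ A : E}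
    (hβ : ∀ u v, β u v = β v u) (hc₀ : 0 ≤ c₀)
    (hβb : ∀ u v, ‖β u v‖ ≤ c₀ / 2 * ‖𝒟 u‖ * ‖𝒟 v‖)
    (hT : ∀ u v w, |quarticThird π β u₀ u v w| ≤ 9 / 4 * c₀ * ‖𝒟 u‖ * ‖𝒟 v‖ * ‖𝒟 w‖)
    (hF : ∀ v w, ⟪F v, w⟫ = quarticHess π σ β u₀ v w + ⟪pen v, w⟫)
    (h₀ : ∀ v, quarticDeriv π σ β h a u₀ v = ⟪pen u₀, v⟫)
    (h₁ : ∀ v, quarticDeriv π σ β h a (u₀ + u) v = ⟪pen (u₀ + u), v⟫ - ⟪A, v⟫)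
    (hb : F b = A) (hφ : ∀ v, ⟪F φ, v⟫ = ⟪A, v⟫ + quarticThird π β u₀ b b v)
    (hc : ∀ v, 1 / 4 * ‖𝒟 v‖ ^ 2 ≤ ⟪F v, v⟫)
    (hcs : ∀ t ∈ ({0, 1 / 2, 1} : Set ℝ), ∀ v,
      1 / 5 * ‖𝒟 v‖ ^ 2 ≤ quarticHess π σ β (u₀ + b + t • (u - b)) v v + ⟪pen v, v⟫)
    (hρ : c₀ * ‖𝒟 b‖ ≤ 2 / 81) :
    ‖𝒟 (u - φ)‖ ≤ 330 * c₀ ^ 2 * ‖𝒟 b‖ ^ 3 := by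
  have hquart : ∀ u v, |2 * ⟪β u u, β u v⟫| ≤ 1 / 2 * c₀ ^ 2 * ‖𝒟 u‖ ^ 3 * ‖𝒟 v‖ := fun u v => by
    have h1 := (abs_real_inner_le_norm (β u u) (β u v)).trans
      (mul_le_mul (hβb u u) (hβb u v) (norm_nonneg _) (by positivity))
    rw [abs_mul, abs_two]
    linarith
  set ρ := ‖𝒟 b‖
  have hρ0 : 0 ≤ ρ := norm_nonneg _
  have hd : ‖𝒟 (u - b)‖ ≤ 5 * (9 / 4 * c₀ * ρ ^ 2 + 1 / 2 * c₀ ^ 2 * ρ ^ 3) := by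
    have hsim := quarticDeriv_sub_eq_simpson (π := π) (σ := σ) (h := h) (a := a) hβ
      (u₀ + b) (u - b)
    have e0 := hcs 0 (by simp) (u - b)
    have e1 := hcs (1 / 2) (by simp) (u - b)
    have e2 := hcs 1 (by simp) (u - b)
    rw [zero_smul, add_zero] at e0
    rw [one_smul] at e2
    have e3 : u₀ + b + (u - b) = u₀ + u := by abel
    rw [e3, h₁, quarticDeriv_add hβ, h₀] at hsim
    rw [e3] at e2
    have h3 := (abs_le.1 (hT b b (u - b))).2
    have h4 := (abs_le.1 (hquart b (u - b))).1
    have h5 := hF b (u - b)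
    rw [hb] at h5
    have h6 : ⟪pen (u₀ + u), u - b⟫ = ⟪pen u₀, u - b⟫ + ⟪pen b, u - b⟫ + ⟪pen (u - b), u - b⟫ := by
      rw [← inner_add_left, ← inner_add_left, ← map_add, ← map_add, add_assoc, add_sub_cancel]
    have key : 1 / 5 * ‖𝒟 (u - b)‖ ^ 2
        ≤ (9 / 4 * c₀ * ρ ^ 2 + 1 / 2 * c₀ ^ 2 * ρ ^ 3) * ‖𝒟 (u - b)‖ := by
      linarith
    rcases (norm_nonneg (𝒟 (u - b))).eq_or_lt with h0 | h0
    · rw [← h0]; positivity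
    · refine le_of_mul_le_mul_left ?_ h0
      linarith
  have hu : ‖𝒟 u‖ ≤ ρ + ‖𝒟 (u - b)‖ := by
    have := norm_add_le (𝒟 b) (𝒟 (u - b))
    rwa [← map_add, add_sub_cancel] at this
  have hub : ‖𝒟 (u + b)‖ ≤ 2 * ρ + ‖𝒟 (u - b)‖ := by
    have := norm_add_le (𝒟 u) (𝒟 b)
    rw [← map_add] at this
    linarith
  set d := ‖𝒟 (u - b)‖
  have hd0 : 0 ≤ d := norm_nonneg _
  -- With `c₀ ρ ≤ 2 / 81`, the correction is below `11.4 c₀ ρ² < 0.3 ρ`.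
  have hcρ : 0 ≤ c₀ * ρ := by positivity
  have hd1 : d ≤ 57 / 5 * c₀ * ρ ^ 2 := by
    have : c₀ ^ 2 * ρ ^ 3 ≤ 2 / 81 * (c₀ * ρ ^ 2) := by
      have := mul_le_mul_of_nonneg_right hρ (show 0 ≤ c₀ * ρ ^ 2 by positivity)
      linarith
    nlinarith [show 0 ≤ c₀ * ρ ^ 2 by positivity]
  have hd2 : d ≤ 3 / 10 * ρ := by nlinarith
  have key := norm_le_of_coercive (𝒟 := 𝒟) (F := F) (c := 1 / 4)
    (B := 9 / 4 * c₀ * d * ‖𝒟 (u + b)‖ + 1 / 2 * c₀ ^ 2 * ‖𝒟 u‖ ^ 3)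
    (by norm_num) (hc (u - φ)) ?_ (by positivity)
  · have h1 : c₀ * d * ‖𝒟 (u + b)‖ ≤ c₀ * (57 / 5 * c₀ * ρ ^ 2) * (23 / 10 * ρ) := by
      gcongr
      linarith
    have h2 : ‖𝒟 u‖ ^ 3 ≤ (13 / 10 * ρ) ^ 3 := by
      gcongr
      linarith
    have h3 := mul_le_mul_of_nonneg_left h2 (sq_nonneg c₀)
    have h4 : 0 ≤ c₀ ^ 2 * ρ ^ 3 := by positivity
    nlinarith
  · have h1 := hF u (u - φ)
    have h2 := h₁ (u - φ)
    rw [quarticDeriv_add hβ, h₀, map_add, inner_add_left] at h2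
    have h3 := quarticThird_sub_sub (π := π) hβ u₀ u b (u - φ)
    have h4 := (abs_le.1 (hT (u - b) (u + b) (u - φ))).2
    have h5 := (abs_le.1 (hquart u (u - φ))).1
    rw [map_sub, inner_sub_left, hφ]
    linarith

end Perturbation

end EiO

/-! ### Coordinates of the parameter and the metric -/

namespace EiO

section Coordinates

open scoped RealInnerProductSpace

variable {Ω : Type*} {p q : ℕ}

lemma inner_param (u v : Param p q) :
    ⟪u, v⟫ = ⟪src u, src v⟫ + ⟪img u, img v⟫ + ⟪vec (opr u), vec (opr v)⟫ := by
  simp [PiLp.inner_apply, Fintype.sum_sum_type, src, img, vec, opr, add_assoc]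

lemma norm_sq_param (u : Param p q) :
    ‖u‖ ^ 2 = ‖src u‖ ^ 2 + ‖img u‖ ^ 2 + ‖vec (opr u)‖ ^ 2 := by
  simp only [← real_inner_self_eq_norm_sq, inner_param]

/-- The source component as a continuous linear map. -/
noncomputable def srcL : Param p q →L[ℝ] EuclideanSpace ℝ (Fin p) :=
  LinearMap.toContinuousLinearMap { toFun := src, map_add' := fun _ _ => rfl,
                                    map_smul' := fun _ _ => rfl }

/-- The image component as a continuous linear map. -/
noncomputable def imgL : Param p q →L[ℝ] EuclideanSpace ℝ (Fin q) :=
  LinearMap.toContinuousLinearMap { toFun := img, map_add' := fun _ _ => rfl,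
                                    map_smul' := fun _ _ => rfl }

/-- The entries of the operator component as a continuous linear map. -/
noncomputable def vecL : Param p q →L[ℝ] EuclideanSpace ℝ (Fin q × Fin p) :=
  LinearMap.toContinuousLinearMap { toFun := fun u => vec (opr u), map_add' := fun _ _ => rfl,
                                    map_smul' := fun _ _ => rfl }

lemma imgL_apply (u : Param p q) : imgL u = img u := rfl
lemma vecL_apply (u : Param p q) : vecL u = vec (opr u) := rfl

lemma src_add (u v : Param p q) : src (u + v) = src u + src v := rfl
lemma opr_add (u v : Param p q) : opr (u + v) = opr u + opr v := rfl
lemma src_smul (c : ℝ) (u : Param p q) : src (c • u) = c • src u := rfl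
lemma opr_smul (c : ℝ) (u : Param p q) : opr (c • u) = c • opr u := rfl
lemma src_sub (u v : Param p q) : src (u - v) = src u - src v := rfl
lemma opr_sub (u v : Param p q) : opr (u - v) = opr u - opr v := rfl

/-- The symmetric bilinear map `½ (A_u θ_v + A_v θ_u)`, whose diagonal is the product `A θ`. -/
noncomputable def prodL : Param p q →L[ℝ] Param p q →L[ℝ] EuclideanSpace ℝ (Fin q) :=
  LinearMap.toContinuousBilinearMap <| LinearMap.mk₂ ℝ
    (fun u v => (1 / 2 : ℝ) • (Matrix.toEuclideanLin (opr u) (src v)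
      + Matrix.toEuclideanLin (opr v) (src u)))
    (fun u v w => by simp only [src_add, opr_add, map_add, LinearMap.add_apply]; module)
    (fun c u v => by simp only [src_smul, opr_smul, map_smul, LinearMap.smul_apply]; module)
    (fun u v w => by simp only [src_add, opr_add, map_add, LinearMap.add_apply]; module)
    (fun c u v => by simp only [src_smul, opr_smul, map_smul, LinearMap.smul_apply]; module)

lemma prodL_apply (u v : Param p q) : prodL u v = (1 / 2 : ℝ) •
    (Matrix.toEuclideanLin (opr u) (src v) + Matrix.toEuclideanLin (opr v) (src u)) := rfl

lemma prodL_comm (u v : Param p q) : prodL u v = prodL v u := by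
  rw [prodL_apply, prodL_apply, add_comm]

lemma prodL_self (u : Param p q) : prodL u u = Matrix.toEuclideanLin (opr u) (src u) := by
  rw [prodL_apply]; module

lemma frob_eq_norm_vec (A : Matrix (Fin q) (Fin p) ℝ) : frob A = ‖vec A‖ := by
  simp [frob, vec, EuclideanSpace.norm_eq, Fintype.sum_prod_type]

lemma frob_nonneg (A : Matrix (Fin q) (Fin p) ℝ) : 0 ≤ frob A := Real.sqrt_nonneg _

lemma norm_toEuclideanLin_le_frob (A : Matrix (Fin q) (Fin p) ℝ) (s : EuclideanSpace ℝ (Fin p)) :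
    ‖Matrix.toEuclideanLin A s‖ ≤ frob A * ‖s‖ := by
  refine abs_le_of_sq_le_sq' ?_ (mul_nonneg (frob_nonneg A) (norm_nonneg s)) |>.2
  rw [mul_pow, frob, Real.sq_sqrt (by positivity), EuclideanSpace.norm_sq_eq,
    EuclideanSpace.norm_sq_eq, Finset.sum_mul]
  refine Finset.sum_le_sum fun i _ => ?_
  simp only [Real.norm_eq_abs, sq_abs, Matrix.ofLp_toLpLin, Matrix.toLin'_apply, Matrix.mulVec,
    dotProduct]
  exact Finset.sum_mul_sq_le_sq_mul_sq _ _ _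

lemma logLik_eq_quartic (M : Model Ω p q) (ω : Ω) (u : Param p q) :
    logLik M ω u = quartic imgL (M.mu • vecL) prodL (M.Z ω) (M.mu • vec (M.Ahat ω)) 0 u := by
  have h1 : M.mu • vec (M.Ahat ω) - M.mu • vec (opr u) = -(M.mu • vec (opr u - M.Ahat ω)) := by
    rw [show vec (opr u - M.Ahat ω) = vec (opr u) - vec (M.Ahat ω) from rfl]; module
  rw [logLik, quartic, prodL_self, smul_apply, vecL_apply, imgL_apply, h1, norm_neg, norm_smul,
    mul_pow, Real.norm_eq_abs, sq_abs, frob_eq_norm_vec]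
  ring

lemma src_metric (M : Model Ω p q) (D : Matrix (Fin p) (Fin p) ℝ) (u : Param p q) :
    src (Matrix.toEuclideanLin (metric M D) u) = Matrix.toEuclideanLin D (src u) := by
  ext j
  simp [src, metric, Matrix.toLpLin_apply, Matrix.mulVec, dotProduct,
    Fintype.sum_sum_type]

lemma img_metric (M : Model Ω p q) (D : Matrix (Fin p) (Fin p) ℝ) (u : Param p q) :
    img (Matrix.toEuclideanLin (metric M D) u) = img u := by
  ext j
  simp [img, metric, Matrix.toLpLin_apply, Matrix.mulVec, dotProduct,
    Fintype.sum_sum_type, Matrix.one_apply]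

lemma vec_metric (M : Model Ω p q) (D : Matrix (Fin p) (Fin p) ℝ) (u : Param p q) :
    vec (opr (Matrix.toEuclideanLin (metric M D) u)) = M.mu • vec (opr u) := by
  ext j
  simp [vec, opr, metric, Matrix.toLpLin_apply, Matrix.mulVec, dotProduct,
    Fintype.sum_sum_type, Matrix.one_apply]

lemma norm_sq_metric (M : Model Ω p q) (D : Matrix (Fin p) (Fin p) ℝ) (u : Param p q) :
    ‖Matrix.toEuclideanLin (metric M D) u‖ ^ 2
      = ‖Matrix.toEuclideanLin D (src u)‖ ^ 2 + ‖img u‖ ^ 2 + (M.mu * frob (opr u)) ^ 2 := by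
  rw [norm_sq_param, src_metric, img_metric, vec_metric, norm_smul, frob_eq_norm_vec, mul_pow,
    mul_pow, Real.norm_eq_abs, sq_abs]

lemma inner_toEuclideanLin_transpose_mul {ι : Type*} [Fintype ι] [DecidableEq ι]
    {κ : Type*} [Fintype κ] (G : Matrix κ ι ℝ) (s t : EuclideanSpace ℝ ι) :
    ⟪Matrix.toEuclideanLin (G.transpose * G) s, t⟫
      = ⟪Matrix.toEuclideanLin G s, Matrix.toEuclideanLin G t⟫ := by
  simp only [EuclideanSpace.inner_eq_star_dotProduct, star_trivial,
    Matrix.ofLp_toLpLin, Matrix.toLin'_apply]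
  rw [← Matrix.mulVec_mulVec, Matrix.dotProduct_mulVec, Matrix.vecMul_transpose]

lemma src_penMat (M : Model Ω p q) (u : Param p q) :
    src (Matrix.toEuclideanLin (penMat M) u)
      = Matrix.toEuclideanLin (M.G.transpose * M.G) (src u) := by
  ext j
  simp [src, penMat, Matrix.toLpLin_apply, Matrix.mulVec, dotProduct,
    Fintype.sum_sum_type]

lemma img_penMat (M : Model Ω p q) (u : Param p q) :
    img (Matrix.toEuclideanLin (penMat M) u) = 0 := by
  ext j
  simp [img, penMat, Matrix.toLpLin_apply, Matrix.mulVec, dotProduct,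
    Fintype.sum_sum_type]

lemma vec_penMat (M : Model Ω p q) (u : Param p q) :
    vec (opr (Matrix.toEuclideanLin (penMat M) u))
      = Matrix.toEuclideanLin (M.K.transpose * M.K) (vec (opr u)) := by
  ext j
  simp [vec, opr, penMat, Matrix.toLpLin_apply, Matrix.mulVec, dotProduct,
    Fintype.sum_sum_type]

lemma inner_penMat (M : Model Ω p q) (u v : Param p q) :
    ⟪Matrix.toEuclideanLin (penMat M) u, v⟫
      = ⟪Matrix.toEuclideanLin M.G (src u), Matrix.toEuclideanLin M.G (src v)⟫
        + ⟪Matrix.toEuclideanLin M.K (vec (opr u)), Matrix.toEuclideanLin M.K (vec (opr v))⟫ := by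
  rw [inner_param, src_penMat, img_penMat, vec_penMat, inner_zero_left, add_zero,
    inner_toEuclideanLin_transpose_mul, inner_toEuclideanLin_transpose_mul]

lemma penLogLik_eq (M : Model Ω p q) (ω : Ω) (u : Param p q) :
    penLogLik M ω u = logLik M ω u - 1 / 2 * ⟪Matrix.toEuclideanLin (penMat M) u, u⟫ := by
  rw [inner_penMat, real_inner_self_eq_norm_sq, real_inner_self_eq_norm_sq, penLogLik]
  ring

lemma inner_le_of_posSemidef_sub {ι : Type*} [Fintype ι] [DecidableEq ι]
    {A B : Matrix ι ι ℝ} (h : (B - A).PosSemidef) (s : EuclideanSpace ℝ ι) :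
    ⟪Matrix.toEuclideanLin A s, s⟫ ≤ ⟪Matrix.toEuclideanLin B s, s⟫ := by
  have := h.dotProduct_mulVec_nonneg s.ofLp
  simp only [EuclideanSpace.inner_eq_star_dotProduct, star_trivial,
    Matrix.ofLp_toLpLin, Matrix.toLin'_apply]
  rw [star_trivial, Matrix.sub_mulVec, dotProduct_sub] at this
  linarith

variable {D : Matrix (Fin p) (Fin p) ℝ}

lemma inner_sq_posDef (hD : D.PosDef) (s : EuclideanSpace ℝ (Fin p)) :
    ⟪Matrix.toEuclideanLin (D * D) s, s⟫ = ‖Matrix.toEuclideanLin D s‖ ^ 2 := by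
  have h1 : D.transpose = D := by
    have := hD.isHermitian
    rwa [Matrix.IsHermitian, Matrix.conjTranspose_eq_transpose_of_trivial] at this
  conv_lhs => rw [← h1]
  nth_rw 2 [h1]
  rw [inner_toEuclideanLin_transpose_mul, real_inner_self_eq_norm_sq]

/-- The Rayleigh bound `N ‖s‖² ≤ ‖D s‖²`. -/
lemma effN_mul_norm_sq_le (hD : D.PosDef) (s : EuclideanSpace ℝ (Fin p)) :
    effN D * ‖s‖ ^ 2 ≤ ‖Matrix.toEuclideanLin D s‖ ^ 2 := by
  have hH : (D * D).IsHermitian := by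
    have := hD.isHermitian
    rw [Matrix.IsHermitian, Matrix.conjTranspose_mul, this]
  have hfin : (spectrum ℝ (D * D)).Finite := by
    rw [hH.spectrum_real_eq_range_eigenvalues]; exact Set.finite_range _
  have hps : (D * D - effN D • (1 : Matrix (Fin p) (Fin p) ℝ)).PosSemidef := by
    have hH' : (D * D - effN D • (1 : Matrix (Fin p) (Fin p) ℝ)).IsHermitian := by
      refine hH.sub ?_
      simp [Matrix.IsHermitian]
    rw [hH'.posSemidef_iff_eigenvalues_nonneg]
    intro i
    have h1 : hH'.eigenvalues i ∈ spectrum ℝ (D * D - effN D • (1 : Matrix (Fin p) (Fin p) ℝ)) := by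
      rw [hH'.spectrum_real_eq_range_eigenvalues]; exact ⟨i, rfl⟩
    have h2 : hH'.eigenvalues i + effN D ∈ spectrum ℝ (D * D) := by
      rw [spectrum.add_mem_iff, Algebra.algebraMap_eq_smul_one, neg_add_eq_sub]
      exact h1
    have h3 : effN D ≤ hH'.eigenvalues i + effN D := csInf_le hfin.bddBelow h2
    simpa using h3
  have h1 := inner_le_of_posSemidef_sub hps s
  rw [inner_sq_posDef hD] at h1
  refine le_trans (le_of_eq ?_) h1
  have h2 : Matrix.toEuclideanLin (1 : Matrix (Fin p) (Fin p) ℝ) s = s := by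
    simp
  rw [map_smul, LinearMap.smul_apply, h2, real_inner_smul_left, real_inner_self_eq_norm_sq]

lemma effN_pos [Nonempty (Fin p)] (hD : D.PosDef) : 0 < effN D := by
  have hH : (D * D).IsHermitian := by
    have := hD.isHermitian
    rw [Matrix.IsHermitian, Matrix.conjTranspose_mul, this]
  have hpd : (D * D).PosDef := by
    have := Matrix.PosDef.conjTranspose_mul_self D (Matrix.mulVec_injective_of_isUnit hD.isUnit)
    rwa [hD.isHermitian] at this
  have hmem : effN D ∈ spectrum ℝ (D * D) := by
    rw [effN, hH.spectrum_real_eq_range_eigenvalues]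
    exact (Set.range_nonempty _).csInf_mem (Set.finite_range _)
  rw [hH.spectrum_real_eq_range_eigenvalues] at hmem
  obtain ⟨i, hi⟩ := hmem
  rw [← hi]
  exact hpd.eigenvalues_pos i

end Coordinates

end EiO

/-! ### Bounds on the local set -/

namespace EiO

section Bounds

open scoped RealInnerProductSpace

variable {Ω : Type*} {p q : ℕ} {M : Model Ω p q} {D : Matrix (Fin p) (Fin p) ℝ}
  {As : Matrix (Fin q) (Fin p) ℝ} {δ : ℝ}

/-- The metric tensor `block{D, I, μ I}` as a continuous linear map. -/
noncomputable def metricL (M : Model Ω p q) (D : Matrix (Fin p) (Fin p) ℝ) :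
    Param p q →L[ℝ] Param p q :=
  LinearMap.toContinuousLinearMap (Matrix.toEuclideanLin (metric M D))

/-- The penalty matrix `block{G², 0, K²}` as a continuous linear map. -/
noncomputable def penL (M : Model Ω p q) : Param p q →L[ℝ] Param p q :=
  LinearMap.toContinuousLinearMap (Matrix.toEuclideanLin (penMat M))

/-- The scale `μ √N` against which products `A θ` are measured. -/
noncomputable def scale (M : Model Ω p q) (D : Matrix (Fin p) (Fin p) ℝ) : ℝ :=
  M.mu * Real.sqrt (effN D)

lemma norm_sq_metricL (u : Param p q) :
    ‖metricL M D u‖ ^ 2 = ‖Matrix.toEuclideanLin D (src u)‖ ^ 2 + ‖img u‖ ^ 2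
      + (M.mu * frob (opr u)) ^ 2 := norm_sq_metric M D u

lemma inner_penL (u v : Param p q) :
    ⟪penL M u, v⟫ = ⟪Matrix.toEuclideanLin M.G (src u), Matrix.toEuclideanLin M.G (src v)⟫
      + ⟪Matrix.toEuclideanLin M.K (vec (opr u)), Matrix.toEuclideanLin M.K (vec (opr v))⟫ :=
  inner_penMat M u v

lemma norm_src_le_metricL (u : Param p q) :
    ‖Matrix.toEuclideanLin D (src u)‖ ≤ ‖metricL M D u‖ := by
  refine (abs_le_of_sq_le_sq' ?_ (norm_nonneg _)).2
  rw [norm_sq_metricL]; nlinarith [sq_nonneg ‖img u‖, sq_nonneg (M.mu * frob (opr u))]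

lemma norm_img_le_metricL (u : Param p q) : ‖img u‖ ≤ ‖metricL M D u‖ := by
  refine (abs_le_of_sq_le_sq' ?_ (norm_nonneg _)).2
  rw [norm_sq_metricL]
  nlinarith [sq_nonneg ‖Matrix.toEuclideanLin D (src u)‖, sq_nonneg (M.mu * frob (opr u))]

lemma frob_le_metricL (u : Param p q) : M.mu * frob (opr u) ≤ ‖metricL M D u‖ := by
  refine (abs_le_of_sq_le_sq' ?_ (norm_nonneg _)).2
  rw [norm_sq_metricL]
  nlinarith [sq_nonneg ‖Matrix.toEuclideanLin D (src u)‖, sq_nonneg ‖img u‖]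

/-- A relaxed local set of relative radius `δ`: the last condition bounds `A - A*` relatively to `D`
as an operator, not in the Frobenius norm, so that the set is stable under small shifts. -/
def region (M : Model Ω p q) (D : Matrix (Fin p) (Fin p) ℝ) (As : Matrix (Fin q) (Fin p) ℝ)
    (δ : ℝ) : Set (Param p q) :=
  {y | ‖Matrix.toEuclideanLin D (src y)‖ ≤ δ * scale M D ∧ ‖img y‖ ≤ δ * scale M D ∧
    ∀ s, ‖Matrix.toEuclideanLin (opr y - As) s‖ ≤ δ * ‖Matrix.toEuclideanLin D s‖}

lemma sqrt_effN_mul_norm_le (hD : D.PosDef) (hN : 0 < effN D) (s : EuclideanSpace ℝ (Fin p)) :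
    Real.sqrt (effN D) * ‖s‖ ≤ ‖Matrix.toEuclideanLin D s‖ := by
  refine (abs_le_of_sq_le_sq' ?_ (norm_nonneg _)).2
  rw [mul_pow, Real.sq_sqrt hN.le]
  exact effN_mul_norm_sq_le hD s

lemma scale_pos (hmu : 0 < M.mu) (hN : 0 < effN D) : 0 < scale M D :=
  mul_pos hmu (Real.sqrt_pos.2 hN)

lemma norm_toEuclideanLin_mul_scale_le (hmu : 0 < M.mu) (hD : D.PosDef) (hN : 0 < effN D)
    (B : Matrix (Fin q) (Fin p) ℝ) (s : EuclideanSpace ℝ (Fin p)) :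
    ‖Matrix.toEuclideanLin B s‖ * scale M D
      ≤ (M.mu * frob B) * ‖Matrix.toEuclideanLin D s‖ := by
  have h1 := norm_toEuclideanLin_le_frob B s
  have h2 := sqrt_effN_mul_norm_le hD hN s
  calc ‖Matrix.toEuclideanLin B s‖ * scale M D
      ≤ (frob B * ‖s‖) * scale M D :=
        mul_le_mul_of_nonneg_right h1 (scale_pos hmu hN).le
    _ = (M.mu * frob B) * (Real.sqrt (effN D) * ‖s‖) := by rw [scale]; ring
    _ ≤ _ := mul_le_mul_of_nonneg_left h2 (mul_nonneg hmu.le (frob_nonneg B))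

lemma norm_prodL_le (hmu : 0 < M.mu) (hD : D.PosDef) (hN : 0 < effN D) (u v : Param p q) :
    ‖prodL u v‖ ≤ (scale M D)⁻¹ / 2 * ‖metricL M D u‖ * ‖metricL M D v‖ := by
  have hk := scale_pos hmu hN
  have h1 := norm_toEuclideanLin_mul_scale_le hmu hD hN (opr u) (src v)
  have h2 := norm_toEuclideanLin_mul_scale_le hmu hD hN (opr v) (src u)
  have h3 : ‖prodL u v‖ ≤ 1 / 2 * (‖Matrix.toEuclideanLin (opr u) (src v)‖
      + ‖Matrix.toEuclideanLin (opr v) (src u)‖) := by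
    rw [prodL_apply, norm_smul, Real.norm_eq_abs, abs_of_pos (by norm_num : (0 : ℝ) < 1 / 2)]
    gcongr
    exact norm_add_le _ _
  have h4 : (M.mu * frob (opr u)) * ‖Matrix.toEuclideanLin D (src v)‖
      + (M.mu * frob (opr v)) * ‖Matrix.toEuclideanLin D (src u)‖
      ≤ ‖metricL M D u‖ * ‖metricL M D v‖ := by
    refine abs_le_of_sq_le_sq' ?_ (by positivity) |>.2
    rw [mul_pow, norm_sq_metricL, norm_sq_metricL]
    generalize M.mu * frob (opr u) = a
    generalize M.mu * frob (opr v) = b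
    generalize ‖Matrix.toEuclideanLin D (src v)‖ = c
    generalize ‖Matrix.toEuclideanLin D (src u)‖ = d
    nlinarith [sq_nonneg (a * b - c * d), mul_nonneg (sq_nonneg ‖img u‖) (sq_nonneg ‖img v‖),
      mul_nonneg (sq_nonneg ‖img u‖) (add_nonneg (sq_nonneg b) (sq_nonneg c)),
      mul_nonneg (sq_nonneg ‖img v‖) (add_nonneg (sq_nonneg a) (sq_nonneg d))]
  have h5 : ‖prodL u v‖ * scale M D ≤ 1 / 2 * (‖metricL M D u‖ * ‖metricL M D v‖) := by
    have := mul_le_mul_of_nonneg_right h3 hk.le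
    linarith
  rw [← le_div_iff₀ hk] at h5
  refine h5.trans (le_of_eq ?_)
  field_simp

/-- The condition `A*ᵀ A* ≤ D²` makes the operators of the region bounded by `(1 + δ) D`. -/
lemma norm_opr_le {y : Param p q} (hy : y ∈ region M D As δ)
    (hDl : ∀ s, ‖Matrix.toEuclideanLin As s‖ ≤ ‖Matrix.toEuclideanLin D s‖)
    (s : EuclideanSpace ℝ (Fin p)) :
    ‖Matrix.toEuclideanLin (opr y) s‖ ≤ (1 + δ) * ‖Matrix.toEuclideanLin D s‖ := by
  have h1 := hy.2.2 s
  have h2 := norm_add_le (Matrix.toEuclideanLin (opr y - As) s) (Matrix.toEuclideanLin As s)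
  rw [← LinearMap.add_apply, ← map_add, sub_add_cancel] at h2
  linarith [hDl s]

lemma norm_opr_src_le (hmu : 0 < M.mu) (hD : D.PosDef) (hN : 0 < effN D)
    {y : Param p q} (hy : y ∈ region M D As δ) (v : Param p q) :
    ‖Matrix.toEuclideanLin (opr v) (src y)‖ ≤ δ * (M.mu * frob (opr v)) := by
  have hk := scale_pos hmu hN
  have h1 := norm_toEuclideanLin_mul_scale_le hmu hD hN (opr v) (src y)
  have h2 := mul_le_mul_of_nonneg_left hy.1 (mul_nonneg hmu.le (frob_nonneg (opr v)))
  refine le_of_mul_le_mul_right ?_ hk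
  linarith

lemma two_smul_prodL (y v : Param p q) : (2 : ℝ) • prodL y v
    = Matrix.toEuclideanLin (opr y) (src v) + Matrix.toEuclideanLin (opr v) (src y) := by
  rw [prodL_apply]; module

lemma norm_residual_deriv_le (hmu : 0 < M.mu) (hD : D.PosDef) (hN : 0 < effN D)
    (hDl : ∀ s, ‖Matrix.toEuclideanLin As s‖ ≤ ‖Matrix.toEuclideanLin D s‖)
    {y : Param p q} (hy : y ∈ region M D As (1 / 10)) (v : Param p q) :
    ‖imgL v - (2 : ℝ) • prodL y v‖ ≤ 149 / 100 * ‖metricL M D v‖ := by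
  have h1 := norm_opr_le hy hDl (src v)
  have h2 := norm_opr_src_le hmu hD hN hy v
  have h3 : ‖imgL v - (2 : ℝ) • prodL y v‖ ≤ ‖img v‖ + (‖Matrix.toEuclideanLin (opr y) (src v)‖
      + ‖Matrix.toEuclideanLin (opr v) (src y)‖) := by
    rw [two_smul_prodL]
    exact (norm_sub_le _ _).trans (add_le_add_right (norm_add_le _ _) _)
  have h4 : ‖img v‖ + (11 / 10 * ‖Matrix.toEuclideanLin D (src v)‖
      + 1 / 10 * (M.mu * frob (opr v))) ≤ 149 / 100 * ‖metricL M D v‖ := by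
    refine abs_le_of_sq_le_sq' ?_ (by positivity) |>.2
    rw [mul_pow, norm_sq_metricL]
    generalize M.mu * frob (opr v) = a
    generalize ‖Matrix.toEuclideanLin D (src v)‖ = d
    generalize ‖img v‖ = w
    nlinarith [sq_nonneg (11 / 10 * w - d), sq_nonneg (1 / 10 * w - a),
      sq_nonneg (1 / 10 * d - 11 / 10 * a)]
  linarith

lemma abs_quarticThird_le (hmu : 0 < M.mu) (hD : D.PosDef) (hN : 0 < effN D)
    (hDl : ∀ s, ‖Matrix.toEuclideanLin As s‖ ≤ ‖Matrix.toEuclideanLin D s‖)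
    {y : Param p q} (hy : y ∈ region M D As (1 / 10)) (u v w : Param p q) :
    |quarticThird imgL prodL y u v w|
      ≤ 9 / 4 * (scale M D)⁻¹ * ‖metricL M D u‖ * ‖metricL M D v‖ * ‖metricL M D w‖ := by
  have key : ∀ a b c : Param p q, |⟪imgL a - (2 : ℝ) • prodL y a, prodL b c⟫|
      ≤ 149 / 200 * (scale M D)⁻¹
        * (‖metricL M D a‖ * ‖metricL M D b‖ * ‖metricL M D c‖) := fun a b c => by
    refine (abs_real_inner_le_norm _ _).trans ((mul_le_mul
      (norm_residual_deriv_le hmu hD hN hDl hy a) (norm_prodL_le hmu hD hN b c)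
      (norm_nonneg _) (by positivity)).trans (le_of_eq (by ring)))
  have h1 := key u v w
  have h2 := key v u w
  have h3 := key w u v
  have h4 : 0 ≤ (scale M D)⁻¹ * (‖metricL M D u‖ * ‖metricL M D v‖ * ‖metricL M D w‖) :=
    mul_nonneg (inv_nonneg.2 (scale_pos hmu hN).le) (by positivity)
  unfold quarticThird
  refine (abs_add_three _ _ _).trans ?_
  linarith

/-- The scalar inequality behind the lower bound of the information matrix. For a direction with
source component `s`, `X`, `W`, `Y` stand for the weighted norms of its three components, `V` for
the norm of the derivative of the residual, `a` for `‖A* s‖` and `g` for `‖G s‖`. The pair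
`(1 / 4, 1 / 10)` serves the local set, the pair `(1 / 5, 1 / 8)` its enlargement. -/
lemma coercivity_aux {X W Y V a g : ℝ} (hX : 0 ≤ X) (hY : 0 ≤ Y) (ha : 0 ≤ a) (haX : a ≤ X)
    (hag : X ^ 2 ≤ a ^ 2 + g ^ 2) {c d : ℝ}
    (hcd : (c = 1 / 4 ∧ d = 1 / 10) ∨ (c = 1 / 5 ∧ d = 1 / 8))
    (hVa : a ≤ W + V + d * (X + Y)) :
    c * (X ^ 2 + W ^ 2 + Y ^ 2)
      ≤ W ^ 2 + Y ^ 2 + V ^ 2 + g ^ 2 - 2 * (d * (2 + d)) * (X * Y) := by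
  have hd : 0 ≤ d := by rcases hcd with h | h <;> rw [h.2] <;> norm_num
  have h1 : a ^ 2 - 2 * d * X * (X + Y) ≤ (W + V) ^ 2 := by
    have h0 : 0 ≤ d * (X + Y) := by positivity
    have : a * (d * (X + Y)) ≤ X * (d * (X + Y)) := mul_le_mul_of_nonneg_right haX h0
    rcases le_total a (d * (X + Y)) with h | h
    · nlinarith [sq_nonneg (W + V)]
    · have : (a - d * (X + Y)) ^ 2 ≤ (W + V) ^ 2 :=
        pow_le_pow_left₀ (by linarith) (by linarith) 2
      nlinarith [sq_nonneg (d * (X + Y))]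
  rcases hcd with ⟨rfl, rfl⟩ | ⟨rfl, rfl⟩
  -- Minimizing over the splitting of `W + V`: `(1 - c) W² + V² ≥ (1 - c) / (2 - c) (W + V)²`.
  · have h2 : 3 / 7 * (W + V) ^ 2 ≤ 3 / 4 * W ^ 2 + V ^ 2 := by
      nlinarith [sq_nonneg (3 * W - 4 * V)]
    nlinarith [sq_nonneg (X - 27 / 10 * Y), sq_nonneg g]
  · have h2 : 4 / 9 * (W + V) ^ 2 ≤ 4 / 5 * W ^ 2 + V ^ 2 := by
      nlinarith [sq_nonneg (4 * W - 5 * V)]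
    nlinarith [sq_nonneg (X - 49 / 20 * Y), sq_nonneg g]

/-- The penalized information dominates a multiple of the squared metric. The residual
`z - A θ` being small, the only negative contribution is absorbed by the other terms. -/
lemma coercive_quarticHess (hmu : 0 < M.mu) (hD : D.PosDef) (hN : 0 < effN D)
    (hDl : ∀ s, ‖Matrix.toEuclideanLin As s‖ ≤ ‖Matrix.toEuclideanLin D s‖)
    (hDu : ∀ s, ‖Matrix.toEuclideanLin D s‖ ^ 2
      ≤ ‖Matrix.toEuclideanLin As s‖ ^ 2 + ‖Matrix.toEuclideanLin M.G s‖ ^ 2)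
    {c : ℝ} (hcd : (c = 1 / 4 ∧ δ = 1 / 10) ∨ (c = 1 / 5 ∧ δ = 1 / 8))
    {y : Param p q} (hy : y ∈ region M D As δ) (v : Param p q) :
    c * ‖metricL M D v‖ ^ 2
      ≤ quarticHess imgL (M.mu • vecL) prodL y v v + ⟪penL M v, v⟫ := by
  have hk := scale_pos hmu hN
  have hd : 0 ≤ δ := by rcases hcd with h | h <;> rw [h.2] <;> norm_num
  set s := src v
  set V := imgL v - (2 : ℝ) • prodL y v with hVdef
  set X := ‖Matrix.toEuclideanLin D s‖
  set Y := M.mu * frob (opr v) with hY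
  have hY0 : 0 ≤ Y := mul_nonneg hmu.le (frob_nonneg _)
  have hVa : ‖Matrix.toEuclideanLin As s‖ ≤ ‖img v‖ + ‖V‖ + δ * (X + Y) := by
    have e : Matrix.toEuclideanLin As s = img v - V - Matrix.toEuclideanLin (opr y - As) s
        - Matrix.toEuclideanLin (opr v) (src y) := by
      rw [hVdef, two_smul_prodL, imgL_apply, map_sub, LinearMap.sub_apply]
      abel
    have h1 := norm_opr_src_le hmu hD hN hy v
    have h2 := hy.2.2 s
    have h3 := norm_sub_le (img v - V - Matrix.toEuclideanLin (opr y - As) s)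
      (Matrix.toEuclideanLin (opr v) (src y))
    have h4 := norm_sub_le (img v - V) (Matrix.toEuclideanLin (opr y - As) s)
    have h5 := norm_sub_le (img v) V
    rw [e]
    linarith
  have hres : ⟪imgL y - prodL y y, prodL v v⟫ ≤ δ * (2 + δ) * (X * Y) := by
    have h1 : ‖imgL y - prodL y y‖ ≤ δ * (2 + δ) * scale M D := by
      have h2 := norm_opr_le hy hDl (src y)
      have h3 := mul_le_mul_of_nonneg_left hy.1 (show 0 ≤ 1 + δ by linarith)
      have h4 := norm_sub_le (imgL y) (prodL y y)
      have h5 := hy.2.1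
      rw [← imgL_apply] at h5
      rw [prodL_self] at h4 ⊢
      linarith
    have h6 := norm_toEuclideanLin_mul_scale_le hmu hD hN (opr v) s
    calc ⟪imgL y - prodL y y, prodL v v⟫ ≤ ‖imgL y - prodL y y‖ * ‖prodL v v‖ :=
          real_inner_le_norm _ _
      _ ≤ (δ * (2 + δ) * scale M D) * ‖prodL v v‖ :=
          mul_le_mul_of_nonneg_right h1 (norm_nonneg _)
      _ = δ * (2 + δ) * (‖Matrix.toEuclideanLin (opr v) s‖ * scale M D) := by
          rw [prodL_self]; ring
      _ ≤ δ * (2 + δ) * (Y * X) := mul_le_mul_of_nonneg_left h6 (by positivity)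
      _ = _ := by ring
  have hG : ⟪penL M v, v⟫ = ‖Matrix.toEuclideanLin M.G s‖ ^ 2
      + ‖Matrix.toEuclideanLin M.K (vec (opr v))‖ ^ 2 := by
    rw [inner_penL, real_inner_self_eq_norm_sq, real_inner_self_eq_norm_sq]
  have hvec : ‖(M.mu • vecL) v‖ = Y := by
    rw [smul_apply, norm_smul, vecL_apply, Real.norm_eq_abs, abs_of_pos hmu, hY,
      frob_eq_norm_vec]
  have key : c * (X ^ 2 + ‖img v‖ ^ 2 + Y ^ 2) ≤ ‖img v‖ ^ 2 + Y ^ 2 + ‖V‖ ^ 2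
      + ‖Matrix.toEuclideanLin M.G s‖ ^ 2 - 2 * (δ * (2 + δ)) * (X * Y) :=
    coercivity_aux (norm_nonneg _) hY0 (norm_nonneg _) (hDl s) (hDu s) hcd hVa
  have e2 : ‖metricL M D v‖ ^ 2 = X ^ 2 + ‖img v‖ ^ 2 + Y ^ 2 := norm_sq_metricL v
  rw [quarticHess, ← hVdef, hG, real_inner_self_eq_norm_sq, real_inner_self_eq_norm_sq,
    real_inner_self_eq_norm_sq, hvec, imgL_apply, e2]
  linarith [sq_nonneg ‖Matrix.toEuclideanLin M.K (vec (opr v))‖]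

lemma localSet_subset_region (hmu : 0 < M.mu) (hD : D.PosDef) {δ₀ : ℝ} (hδ : δ₀ ≤ δ) :
    localSet M D δ₀ As ⊆ region M D As δ := by
  rintro y ⟨h1, h2, h3⟩
  have hR : radius M D δ₀ ≤ δ * scale M D := by
    rw [radius, scale, mul_assoc]
    exact mul_le_mul_of_nonneg_right hδ (mul_nonneg hmu.le (Real.sqrt_nonneg _))
  refine ⟨h1.trans hR, h2.trans hR, fun s => ?_⟩
  have h4 := norm_toEuclideanLin_le_frob ((opr y - As) * D⁻¹) (Matrix.toEuclideanLin D s)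
  have e : Matrix.toEuclideanLin ((opr y - As) * D⁻¹) (Matrix.toEuclideanLin D s)
      = Matrix.toEuclideanLin (opr y - As) s := by
    simp only [Matrix.toLpLin_apply, Matrix.mulVec_mulVec]
    rw [Matrix.mul_assoc, Matrix.nonsing_inv_mul _ ((Matrix.isUnit_iff_isUnit_det D).1 hD.isUnit),
      Matrix.mul_one]
  rw [e] at h4
  exact h4.trans (mul_le_mul_of_nonneg_right (h3.trans hδ) (norm_nonneg _))

lemma region_add (hmu : 0 < M.mu) (hD : D.PosDef) (hN : 0 < effN D) {y b : Param p q} {ε : ℝ}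
    (hy : y ∈ region M D As δ) (hb : (scale M D)⁻¹ * ‖metricL M D b‖ ≤ ε) :
    y + b ∈ region M D As (δ + ε) := by
  have hk := scale_pos hmu hN
  have hb' : ‖metricL M D b‖ ≤ ε * scale M D := by
    rwa [inv_mul_le_iff₀ hk, mul_comm] at hb
  refine ⟨?_, ?_, fun s => ?_⟩
  · have h1 := norm_add_le (Matrix.toEuclideanLin D (src y)) (Matrix.toEuclideanLin D (src b))
    rw [← map_add, ← src_add] at h1
    linarith [hy.1, norm_src_le_metricL (M := M) (D := D) b]
  · have h1 := norm_add_le (imgL y) (imgL b)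
    rw [← map_add] at h1
    simp only [imgL_apply] at h1
    linarith [hy.2.1, norm_img_le_metricL (M := M) (D := D) b]
  · have h1 := norm_add_le (Matrix.toEuclideanLin (opr y - As) s)
      (Matrix.toEuclideanLin (opr b) s)
    rw [← LinearMap.add_apply, ← map_add, sub_add_eq_add_sub, ← opr_add] at h1
    have h2 : ‖Matrix.toEuclideanLin (opr b) s‖ ≤ ε * ‖Matrix.toEuclideanLin D s‖ := by
      have h3 := norm_toEuclideanLin_mul_scale_le hmu hD hN (opr b) s
      have h4 := mul_le_mul_of_nonneg_right ((frob_le_metricL (M := M) (D := D) b).trans hb')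
        (norm_nonneg (Matrix.toEuclideanLin D s))
      refine le_of_mul_le_mul_right ?_ hk
      linarith
    linarith [hy.2.2 s]

lemma norm_segment_le {V : Type*} [NormedAddCommGroup V] [NormedSpace ℝ V] {a b : V} {r t : ℝ}
    (ha : ‖a‖ ≤ r) (hb : ‖b‖ ≤ r) (ht : t ∈ Set.Icc (0 : ℝ) 1) : ‖a + t • (b - a)‖ ≤ r := by
  have h1 : a + t • (b - a) = (1 - t) • a + t • b := by module
  rw [h1]
  refine (norm_add_le _ _).trans ?_
  rw [norm_smul, norm_smul, Real.norm_of_nonneg ht.1, Real.norm_of_nonneg (by linarith [ht.2])]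
  nlinarith [ht.1, ht.2]

/-- The region is convex. -/
lemma region_segment {y z : Param p q} (hy : y ∈ region M D As δ) (hz : z ∈ region M D As δ)
    {t : ℝ} (ht : t ∈ Set.Icc (0 : ℝ) 1) : y + t • (z - y) ∈ region M D As δ := by
  obtain ⟨hy1, hy2, hy3⟩ := hy
  obtain ⟨hz1, hz2, hz3⟩ := hz
  refine ⟨?_, ?_, fun s => ?_⟩
  · have e : Matrix.toEuclideanLin D (src (y + t • (z - y))) = Matrix.toEuclideanLin D (src y)
        + t • (Matrix.toEuclideanLin D (src z) - Matrix.toEuclideanLin D (src y)) := by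
      rw [src_add, src_smul, src_sub, map_add, map_smul, map_sub]
    rw [e]
    exact norm_segment_le hy1 hz1 ht
  · have e : img (y + t • (z - y)) = img y + t • (img z - img y) := by
      simp only [← imgL_apply, map_add, map_smul, map_sub]
    rw [e]
    exact norm_segment_le hy2 hz2 ht
  · have e1 : opr (y + t • (z - y)) - As = (opr y - As) + t • ((opr z - As) - (opr y - As)) := by
      rw [opr_add, opr_smul, opr_sub, sub_sub_sub_cancel_right]
      abel
    have e : ∀ B C : Matrix (Fin q) (Fin p) ℝ, Matrix.toEuclideanLin (B + t • (C - B)) s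
        = Matrix.toEuclideanLin B s
          + t • (Matrix.toEuclideanLin C s - Matrix.toEuclideanLin B s) := fun B C => by
      simp only [map_add, map_smul, map_sub, LinearMap.add_apply, LinearMap.smul_apply,
        LinearMap.sub_apply]
    rw [e1, e]
    exact norm_segment_le (hy3 s) (hz3 s) ht

lemma inner_penL_comm (u v : Param p q) : ⟪penL M u, v⟫ = ⟪penL M v, u⟫ := by
  rw [inner_penL, inner_penL, real_inner_comm, real_inner_comm (Matrix.toEuclideanLin M.K _)]

lemma metricL_eq_zero (hmu : 0 < M.mu) (hD : D.PosDef)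
    {v : Param p q} (hv : metricL M D v = 0) : v = 0 := by
  have h1 := norm_sq_metricL (M := M) (D := D) v
  rw [hv, norm_zero] at h1
  have h2 : ‖Matrix.toEuclideanLin D (src v)‖ = 0 := by
    nlinarith [norm_nonneg (Matrix.toEuclideanLin D (src v)), sq_nonneg ‖img v‖,
      sq_nonneg (M.mu * frob (opr v))]
  have h3 : ‖img v‖ = 0 := by
    nlinarith [norm_nonneg (img v), sq_nonneg (M.mu * frob (opr v))]
  have h4 : M.mu * frob (opr v) = 0 := by
    nlinarith
  rw [mul_eq_zero, or_iff_right hmu.ne', frob_eq_norm_vec] at h4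
  have h5 : src v = 0 := by
    have e : D.mulVec (src v).ofLp = D.mulVec 0 := by
      rw [Matrix.mulVec_zero]
      exact congrArg WithLp.ofLp (norm_eq_zero.1 h2)
    exact WithLp.ofLp_injective 2 (Matrix.mulVec_injective_of_isUnit hD.isUnit e)
  have h6 := norm_sq_param v
  rw [h5, h3, h4, norm_zero] at h6
  exact norm_eq_zero.1 (by nlinarith)

lemma norm_map_src_le {m : ℕ} (hD : D.PosDef)
    (Q : EuclideanSpace ℝ (Fin p) →L[ℝ] EuclideanSpace ℝ (Fin m)) (v : Param p q) :
    ‖Q (src v)‖ ≤ normQD Q D * ‖metricL M D v‖ := by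
  have h1 : Q (src v) = (Q.comp (Matrix.toEuclideanCLM (𝕜 := ℝ) D⁻¹))
      (Matrix.toEuclideanLin D (src v)) := by
    have e : Matrix.toEuclideanLin D⁻¹ (Matrix.toEuclideanLin D (src v)) = src v := by
      simp only [Matrix.toLpLin_apply, Matrix.mulVec_mulVec]
      rw [Matrix.nonsing_inv_mul _ ((Matrix.isUnit_iff_isUnit_det D).1 hD.isUnit),
        Matrix.one_mulVec]
    exact congrArg Q e.symm
  rw [h1]
  exact (ContinuousLinearMap.le_opNorm _ _).trans
    (mul_le_mul_of_nonneg_left (norm_src_le_metricL v) (norm_nonneg _))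

lemma quarticDeriv_of_isMaxOn_penLogLik {ω : Ω} {u : Param p q}
    (hu : IsMaxOn (penLogLik M ω) Set.univ u) (v : Param p q) :
    quarticDeriv imgL (M.mu • vecL) prodL (M.Z ω) (M.mu • vec (M.Ahat ω)) u v
      = ⟪penL M u, v⟫ := by
  have e : penLogLik M ω = fun u => quartic imgL (M.mu • vecL) prodL (M.Z ω)
      (M.mu • vec (M.Ahat ω)) 0 u - 1 / 2 * ⟪penL M u, u⟫ := funext fun u => by
    rw [penLogLik_eq, logLik_eq_quartic]
    rfl
  rw [e] at hu
  exact quarticDeriv_eq_of_isMaxOn prodL_comm inner_penL_comm hu v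

lemma tau3_eq : tau3 M D = 9 / 2 * (scale M D)⁻¹ := by
  rw [tau3, scale, mul_comm M.mu, div_eq_mul_inv]

lemma tau4_eq (hN : 0 ≤ effN D) : tau4 M D = 3 * (scale M D)⁻¹ ^ 2 := by
  rw [tau4, scale, inv_pow, mul_pow, Real.sq_sqrt hN, mul_comm (M.mu ^ 2), div_eq_mul_inv]

lemma norm_toEuclideanLin_le_of_posSemidef (hD : D.PosDef)
    (h : (D * D - As.transpose * As).PosSemidef) (s : EuclideanSpace ℝ (Fin p)) :
    ‖Matrix.toEuclideanLin As s‖ ≤ ‖Matrix.toEuclideanLin D s‖ := by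
  have h1 := inner_le_of_posSemidef_sub h s
  rw [inner_sq_posDef hD, inner_toEuclideanLin_transpose_mul, real_inner_self_eq_norm_sq] at h1
  exact (abs_le_of_sq_le_sq' h1 (norm_nonneg _)).2

lemma norm_sq_le_of_posSemidef_add {G : Matrix (Fin p) (Fin p) ℝ} (hD : D.PosDef)
    (h : (As.transpose * As + G.transpose * G - D * D).PosSemidef)
    (s : EuclideanSpace ℝ (Fin p)) : ‖Matrix.toEuclideanLin D s‖ ^ 2
      ≤ ‖Matrix.toEuclideanLin As s‖ ^ 2 + ‖Matrix.toEuclideanLin G s‖ ^ 2 := by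
  have h1 := inner_le_of_posSemidef_sub h s
  rwa [map_add, LinearMap.add_apply, inner_add_left, inner_sq_posDef hD,
    inner_toEuclideanLin_transpose_mul, inner_toEuclideanLin_transpose_mul,
    real_inner_self_eq_norm_sq, real_inner_self_eq_norm_sq] at h1

end Bounds

end EiO

/-! ### Moment inequalities -/

namespace EiO

section Moments

open scoped ENNReal RealInnerProductSpace

variable {Ω V : Type*} [MeasurableSpace Ω] [NormedAddCommGroup V] {ν : Measure Ω}

lemma lpNorm_two_eq_sqrt {f : Ω → V} (hf : AEStronglyMeasurable f ν) :
    lpNorm f 2 ν = Real.sqrt (∫ ω, ‖f ω‖ ^ 2 ∂ν) := by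
  rw [lpNorm_eq_integral_norm_rpow_toReal (by norm_num) (by norm_num) hf, Real.sqrt_eq_rpow]
  simp

/-- Minkowski's inequality for two random vectors at distance at most `k (Y ^ n + b ^ n)`. -/
lemma abs_sqrt_integral_sub_le (hν : ν.real Set.univ ≤ 1) [IsFiniteMeasure ν] {f g : Ω → V}
    (hf : MemLp f 2 ν) (hg : MemLp g 2 ν) {Y : Ω → ℝ} (hY : AEStronglyMeasurable Y ν)
    {r : ℝ} (hYr : ∀ᵐ ω ∂ν, ‖Y ω‖ ≤ r) {k b S : ℝ} {n : ℕ} (hk : 0 ≤ k) (hb : 0 ≤ b)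
    (hS : 0 ≤ S) (hfg : ∀ᵐ ω ∂ν, ‖f ω - g ω‖ ≤ k * (Y ω ^ n + b ^ n))
    (hm : ∫ ω, Y ω ^ (2 * n) ∂ν ≤ S ^ 2) :
    |Real.sqrt (∫ ω, ‖f ω‖ ^ 2 ∂ν) - Real.sqrt (∫ ω, ‖g ω‖ ^ 2 ∂ν)| ≤ k * (S + b ^ n) := by
  have hYn : MemLp (fun ω => Y ω ^ n) 2 ν := by
    refine MemLp.of_bound (hY.pow n) (r ^ n) ?_
    filter_upwards [hYr] with ω h
    rw [norm_pow]
    exact pow_le_pow_left₀ (norm_nonneg _) h n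
  have hbn : MemLp (fun _ : Ω => b ^ n) 2 ν := memLp_const _
  have hsum : MemLp (fun ω => Y ω ^ n + b ^ n) 2 ν := hYn.add hbn
  have h1 : lpNorm (fun ω => Y ω ^ n + b ^ n) 2 ν ≤ S + b ^ n := by
    refine (lpNorm_add_le hYn (by norm_num)).trans (add_le_add ?_ ?_)
    · rw [lpNorm_two_eq_sqrt hYn.1]
      refine Real.sqrt_le_iff.2 ⟨hS, le_trans (le_of_eq ?_) hm⟩
      refine integral_congr_ae (Filter.Eventually.of_forall fun ω => ?_)
      simp only [Real.norm_eq_abs, sq_abs]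
      ring
    · rw [lpNorm_two_eq_sqrt hbn.1]
      refine Real.sqrt_le_iff.2 ⟨by positivity, ?_⟩
      rw [integral_const, smul_eq_mul, Real.norm_of_nonneg (by positivity)]
      exact mul_le_of_le_one_left (by positivity) hν
  have h2 : lpNorm (f - g) 2 ν ≤ k * lpNorm (fun ω => Y ω ^ n + b ^ n) 2 ν := by
    rw [lpNorm_two_eq_sqrt (hf.sub hg).1, lpNorm_two_eq_sqrt hsum.1]
    have : k * Real.sqrt (∫ ω, ‖Y ω ^ n + b ^ n‖ ^ 2 ∂ν)
        = Real.sqrt (∫ ω, k ^ 2 * ‖Y ω ^ n + b ^ n‖ ^ 2 ∂ν) := by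
      rw [integral_const_mul, Real.sqrt_mul (sq_nonneg k), Real.sqrt_sq hk]
    rw [this]
    refine Real.sqrt_le_sqrt (integral_mono_ae ((hf.sub hg).integrable_norm_pow (by norm_num))
      ((hsum.integrable_norm_pow (by norm_num)).const_mul _) ?_)
    filter_upwards [hfg] with ω h
    simp only [Pi.sub_apply]
    rw [← mul_pow]
    refine pow_le_pow_left₀ (norm_nonneg _) (h.trans ?_) 2
    exact mul_le_mul_of_nonneg_left (Real.le_norm_self _) hk
  have h3 := lpNorm_le_lpNorm_add_lpNorm_sub (f := f) hg (p := 2) (by norm_num)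
  have h4 := lpNorm_le_lpNorm_add_lpNorm_sub (f := g) hf (p := 2) (by norm_num)
  rw [lpNorm_sub_comm] at h4
  have h5 := h2.trans (mul_le_mul_of_nonneg_left h1 hk)
  rw [← lpNorm_two_eq_sqrt hf.1, ← lpNorm_two_eq_sqrt hg.1, abs_le]
  rw [lpNorm_sub_comm] at h5
  constructor <;> linarith [lpNorm_sub_comm f g 2 ν]

/-- The first-moment counterpart of `abs_sqrt_integral_sub_le`. -/
lemma abs_integral_norm_sub_le (hν : ν.real Set.univ ≤ 1) [IsFiniteMeasure ν] {f g : Ω → V}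
    (hf : MemLp f 2 ν) (hg : MemLp g 2 ν) {Y : Ω → ℝ} (hY : AEStronglyMeasurable Y ν)
    {r : ℝ} (hYr : ∀ᵐ ω ∂ν, ‖Y ω‖ ≤ r) {k b S : ℝ} {n : ℕ} (hk : 0 ≤ k) (hb : 0 ≤ b)
    (hfg : ∀ᵐ ω ∂ν, ‖f ω - g ω‖ ≤ k * (Y ω ^ n + b ^ n))
    (hm : ∫ ω, Y ω ^ n ∂ν ≤ S) :
    |∫ ω, ‖f ω‖ ∂ν - ∫ ω, ‖g ω‖ ∂ν| ≤ k * (S + b ^ n) := by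
  have hYn : Integrable (fun ω => Y ω ^ n) ν := by
    refine Integrable.of_bound (hY.pow n) (r ^ n) ?_
    filter_upwards [hYr] with ω h
    rw [norm_pow]
    exact pow_le_pow_left₀ (norm_nonneg _) h n
  have hf1 := (hf.integrable (by norm_num)).norm
  have hg1 := (hg.integrable (by norm_num)).norm
  rw [← integral_sub hf1 hg1]
  calc |∫ ω, (‖f ω‖ - ‖g ω‖) ∂ν| ≤ ∫ ω, |‖f ω‖ - ‖g ω‖| ∂ν := abs_integral_le_integral_abs
    _ ≤ ∫ ω, k * (Y ω ^ n + b ^ n) ∂ν := by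
        refine integral_mono_ae (hf1.sub hg1).abs
          ((hYn.add (integrable_const _)).const_mul _) ?_
        filter_upwards [hfg] with ω h
        exact (abs_norm_sub_norm_le _ _).trans h
    _ = k * (∫ ω, Y ω ^ n ∂ν + ν.real Set.univ * b ^ n) := by
        rw [integral_const_mul, integral_add hYn (integrable_const _), integral_const,
          smul_eq_mul]
    _ ≤ k * (S + b ^ n) := by
        have := mul_le_of_le_one_left (pow_nonneg hb n) hν
        gcongr

/-- The second moment of a centred random vector is the trace of its covariance matrix. -/
lemma integral_norm_sq_eq_trace_varMat {ι : Type*} [Fintype ι] {X : Ω → EuclideanSpace ℝ ι}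
    [IsProbabilityMeasure ν] (hX : MemLp X 2 ν) (h0 : ∫ ω, X ω ∂ν = 0) :
    ∫ ω, ‖X ω‖ ^ 2 ∂ν = (varMat ν X).trace := by
  have hc : ∀ i, MemLp (fun ω => X ω i) 2 ν := fun i => hX.eval_piLp i
  simp only [EuclideanSpace.norm_sq_eq, Real.norm_eq_abs, sq_abs]
  rw [integral_finsetSum _ fun i _ => (hc i).integrable_sq, Matrix.trace]
  refine Finset.sum_congr rfl fun i _ => ?_
  have h1 : ∫ ω, X ω i ∂ν = 0 := by
    have h2 : ∫ ω, X ω i ∂ν = (∫ ω, X ω ∂ν) i :=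
      (EuclideanSpace.proj (𝕜 := ℝ) i).integral_comp_comm (hX.integrable (by norm_num))
    rw [h2, h0]
    rfl
  rw [Matrix.diag_apply, varMat, covariance_self (hc i).1.aemeasurable,
    variance_of_integral_eq_zero (hc i).1.aemeasurable h1]

/-- The bias-variance decomposition of the mean squared distance to a fixed point. -/
lemma integral_norm_sub_sq [InnerProductSpace ℝ V] [CompleteSpace V] [IsProbabilityMeasure ν]
    {X : Ω → V} (hX : MemLp X 2 ν) (v : V) :
    Integrable (fun ω => ‖X ω - v‖ ^ 2) ν ∧ ∫ ω, ‖X ω - v‖ ^ 2 ∂ν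
      = ‖∫ ω, X ω ∂ν - v‖ ^ 2 + (∫ ω, ‖X ω‖ ^ 2 ∂ν - ‖∫ ω, X ω ∂ν‖ ^ 2) := by
  have hi := hX.integrable (by norm_num)
  have h2 := hX.integrable_norm_pow (by norm_num)
  have hin : Integrable (fun ω => ⟪X ω, v⟫) ν := hi.inner_const v
  have hd : Integrable (fun ω => ‖X ω‖ ^ 2 - 2 * ⟪X ω, v⟫) ν := h2.sub (hin.const_mul 2)
  refine ⟨(hX.sub (memLp_const v)).integrable_norm_pow (by norm_num), ?_⟩
  simp only [norm_sub_sq_real]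
  rw [integral_add hd (integrable_const _),
    integral_sub h2 (hin.const_mul 2), integral_const_mul, integral_const]
  have h3 : ∫ ω, ⟪X ω, v⟫ ∂ν = ⟪∫ ω, X ω ∂ν, v⟫ := by
    simp only [real_inner_comm v]
    exact integral_inner hi v
  rw [h3]
  simp
  ring

end Moments

end EiO

/-! ### The score and the information matrix -/

namespace EiO

section Model

open scoped RealInnerProductSpace

variable {Ω : Type*} [MeasurableSpace Ω] {P : Measure Ω} {p q : ℕ} {M : Model Ω p q}

/-- The mean of the image data. -/
noncomputable def meanZ (P : Measure Ω) (M : Model Ω p q) : EuclideanSpace ℝ (Fin q) :=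
  ∫ ω, M.Z ω ∂P

/-- The mean of the weighted pilot estimate `μ vec Â`. -/
noncomputable def meanA (P : Measure Ω) (M : Model Ω p q) : EuclideanSpace ℝ (Fin q × Fin p) :=
  ∫ ω, M.mu • vec (M.Ahat ω) ∂P

/-- The constant by which the expected log-likelihood differs from the log-likelihood at the mean
of the data. -/
noncomputable def meanConst (P : Measure Ω) (M : Model Ω p q) : ℝ :=
  -(1 / 2) * (∫ ω, ‖M.Z ω‖ ^ 2 ∂P - ‖meanZ P M‖ ^ 2)
    - 1 / 2 * (∫ ω, ‖M.mu • vec (M.Ahat ω)‖ ^ 2 ∂P - ‖meanA P M‖ ^ 2)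

lemma memLp_vec (hA : ∀ i j, MemLp (fun ω => M.Ahat ω i j) 2 P) :
    MemLp (fun ω => M.mu • vec (M.Ahat ω)) 2 P :=
  (MemLp.of_eval_piLp fun i => hA i.1 i.2).const_smul M.mu

lemma meanLogLik_eq_quartic [IsProbabilityMeasure P]
    (hZ : MemLp M.Z 2 P) (hA : ∀ i j, MemLp (fun ω => M.Ahat ω i j) 2 P) :
    (∀ u, Integrable (fun ω => logLik M ω u) P) ∧ meanLogLik P M
      = quartic imgL (M.mu • vecL) prodL (meanZ P M) (meanA P M) (meanConst P M) := by
  have h1 := fun u : Param p q => integral_norm_sub_sq hZ (imgL u)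
  have h2 := fun u : Param p q => integral_norm_sub_sq (memLp_vec hA) ((M.mu • vecL) u)
  have hi : ∀ u : Param p q, Integrable (fun ω => 0 - 1 / 2 * ‖M.Z ω - imgL u‖ ^ 2
      - 1 / 2 * ‖M.mu • vec (M.Ahat ω) - (M.mu • vecL) u‖ ^ 2) P := fun u =>
    ((integrable_const 0).sub ((h1 u).1.const_mul _)).sub ((h2 u).1.const_mul _)
  refine ⟨fun u => ?_, funext fun u => ?_⟩
  · simp only [logLik_eq_quartic, quartic]
    exact (hi u).sub (integrable_const _)
  · simp only [meanLogLik, logLik_eq_quartic, quartic]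
    have hi1 : Integrable (fun ω => 0 - 1 / 2 * ‖M.Z ω - imgL u‖ ^ 2) P :=
      (integrable_const 0).sub ((h1 u).1.const_mul _)
    rw [integral_sub (hi u) (integrable_const _), integral_sub hi1 ((h2 u).1.const_mul _),
      integral_sub (integrable_const (0 : ℝ)) ((h1 u).1.const_mul _), integral_const_mul,
      integral_const_mul, (h1 u).2, (h2 u).2]
    simp only [integral_const, probReal_univ, one_smul, meanConst, meanZ, meanA]
    ring

lemma quarticDeriv_of_isMaxOn_meanLogLik [IsProbabilityMeasure P]
    (hZ : MemLp M.Z 2 P) (hA : ∀ i j, MemLp (fun ω => M.Ahat ω i j) 2 P) {u : Param p q}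
    (hu : IsMaxOn (meanLogLik P M) Set.univ u) (v : Param p q) :
    quarticDeriv imgL (M.mu • vecL) prodL (meanZ P M) (meanA P M) u v = 0 := by
  rw [(meanLogLik_eq_quartic hZ hA).2] at hu
  have := quarticDeriv_eq_of_isMaxOn (L := 0) prodL_comm (by simp) (by simpa using hu) v
  simpa using this

lemma quarticDeriv_of_isMaxOn_meanPenLogLik [IsProbabilityMeasure P]
    (hZ : MemLp M.Z 2 P) (hA : ∀ i j, MemLp (fun ω => M.Ahat ω i j) 2 P) {u : Param p q}
    (hu : IsMaxOn (meanPenLogLik P M) Set.univ u) (v : Param p q) :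
    quarticDeriv imgL (M.mu • vecL) prodL (meanZ P M) (meanA P M) u v = ⟪penL M u, v⟫ := by
  have e : meanPenLogLik P M = fun u => quartic imgL (M.mu • vecL) prodL (meanZ P M) (meanA P M)
      (meanConst P M) u - 1 / 2 * ⟪penL M u, u⟫ := funext fun u => by
    simp only [meanPenLogLik, penLogLik_eq]
    rw [integral_sub ((meanLogLik_eq_quartic hZ hA).1 u) (integrable_const _), integral_const,
      probReal_univ, one_smul, ← (meanLogLik_eq_quartic hZ hA).2]
    rfl
  rw [e] at hu
  exact quarticDeriv_eq_of_isMaxOn prodL_comm inner_penL_comm hu v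

/-- The score does not depend on the parameter. -/
lemma score_eq [IsProbabilityMeasure P]
    (hZ : MemLp M.Z 2 P) (hA : ∀ i j, MemLp (fun ω => M.Ahat ω i j) 2 P) (u : Param p q) (ω : Ω) :
    score P M u ω = ContinuousLinearMap.adjoint imgL (M.Z ω - meanZ P M)
      + ContinuousLinearMap.adjoint (M.mu • vecL : Param p q →L[ℝ] _)
        (M.mu • vec (M.Ahat ω) - meanA P M) := by
  refine ext_inner_right ℝ fun v => ?_
  rw [score, inner_gradient_left, (meanLogLik_eq_quartic hZ hA).2, inner_add_left,
    ContinuousLinearMap.adjoint_inner_left, ContinuousLinearMap.adjoint_inner_left]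
  simp only [logLik_eq_quartic]
  have hd : ∀ (h : EuclideanSpace ℝ (Fin q)) (a : EuclideanSpace ℝ (Fin q × Fin p)) (c : ℝ),
      DifferentiableAt ℝ (quartic imgL (M.mu • vecL) prodL h a c) u :=
    fun h a c => contDiff_quartic.differentiable one_ne_zero u
  have h1 := fderiv_fun_sub (hd (M.Z ω) (M.mu • vec (M.Ahat ω)) 0)
    (hd (meanZ P M) (meanA P M) (meanConst P M))
  rw [h1, sub_apply, fderiv_quartic_apply prodL_comm, fderiv_quartic_apply prodL_comm]
  simp only [quarticDeriv, inner_sub_left]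
  ring

lemma quarticDeriv_data_eq [IsProbabilityMeasure P]
    (hZ : MemLp M.Z 2 P) (hA : ∀ i j, MemLp (fun ω => M.Ahat ω i j) 2 P) (u w v : Param p q)
    (ω : Ω) : quarticDeriv imgL (M.mu • vecL) prodL (M.Z ω) (M.mu • vec (M.Ahat ω)) u v
      = quarticDeriv imgL (M.mu • vecL) prodL (meanZ P M) (meanA P M) u v
        + ⟪score P M w ω, v⟫ := by
  rw [score_eq hZ hA, inner_add_left, ContinuousLinearMap.adjoint_inner_left,
    ContinuousLinearMap.adjoint_inner_left]
  simp only [quarticDeriv, inner_sub_left]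
  ring

lemma memLp_score [IsProbabilityMeasure P]
    (hZ : MemLp M.Z 2 P) (hA : ∀ i j, MemLp (fun ω => M.Ahat ω i j) 2 P) (u : Param p q) :
    MemLp (score P M u) 2 P ∧ ∫ ω, score P M u ω ∂P = 0 := by
  have hA' := memLp_vec hA
  have h1 : MemLp (fun ω => M.Z ω - meanZ P M) 2 P := hZ.sub (memLp_const _)
  have h2 : MemLp (fun ω => M.mu • vec (M.Ahat ω) - meanA P M) 2 P := hA'.sub (memLp_const _)
  have h3 : MemLp (fun ω => ContinuousLinearMap.adjoint (imgL : Param p q →L[ℝ] _)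
      (M.Z ω - meanZ P M)) 2 P := ContinuousLinearMap.comp_memLp' _ h1
  have h4 : MemLp (fun ω => ContinuousLinearMap.adjoint (M.mu • vecL : Param p q →L[ℝ] _)
      (M.mu • vec (M.Ahat ω) - meanA P M)) 2 P := ContinuousLinearMap.comp_memLp' _ h2
  have e : score P M u = fun ω => ContinuousLinearMap.adjoint imgL (M.Z ω - meanZ P M)
      + ContinuousLinearMap.adjoint (M.mu • vecL : Param p q →L[ℝ] _)
        (M.mu • vec (M.Ahat ω) - meanA P M) := funext fun ω => score_eq hZ hA u ω
  rw [e]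
  refine ⟨h3.add h4, ?_⟩
  beta_reduce
  have i3 := h3.integrable (by norm_num)
  have i4 := h4.integrable (by norm_num)
  rw [integral_add i3 i4,
    ContinuousLinearMap.integral_comp_comm _ (h1.integrable (by norm_num)),
    ContinuousLinearMap.integral_comp_comm _ (h2.integrable (by norm_num)),
    integral_sub (hZ.integrable (by norm_num)) (integrable_const _),
    integral_sub (hA'.integrable (by norm_num)) (integrable_const _)]
  simp [meanZ, meanA]

/-- The matrix of a bilinear form in the standard basis represents it. -/
lemma inner_toEuclideanLin_of_bilinear {ι : Type*} [Fintype ι] [DecidableEq ι]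
    (b : EuclideanSpace ℝ ι →L[ℝ] EuclideanSpace ℝ ι →L[ℝ] ℝ) {B : Matrix ι ι ℝ}
    (hB : ∀ i j, B i j = b (EuclideanSpace.single i 1) (EuclideanSpace.single j 1))
    (v w : EuclideanSpace ℝ ι) : ⟪Matrix.toEuclideanLin B v, w⟫ = b w v := by
  have hs : ∀ v : EuclideanSpace ℝ ι, v = ∑ i, v i • EuclideanSpace.single i (1 : ℝ) := fun v => by
    ext j
    simp [Finset.sum_apply, Pi.single_apply]
  conv_rhs => rw [hs w, hs v]
  simp only [map_sum, map_smul, sum_apply, smul_apply, smul_eq_mul, Finset.mul_sum]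
  rw [PiLp.inner_apply, Finset.sum_comm]
  refine Finset.sum_congr rfl fun i _ => ?_
  simp only [Matrix.toLpLin_apply, Matrix.mulVec, dotProduct, RCLike.inner_apply, conj_trivial]
  rw [Finset.mul_sum]
  refine Finset.sum_congr rfl fun j _ => ?_
  rw [hB]
  ring

/-- The penalized information matrix as a continuous linear map. -/
noncomputable def infoL (P : Measure Ω) (M : Model Ω p q) (u : Param p q) :
    Param p q →L[ℝ] Param p q :=
  LinearMap.toContinuousLinearMap (Matrix.toEuclideanLin (penInfo P M u))

lemma inner_infoL [IsProbabilityMeasure P]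
    (hZ : MemLp M.Z 2 P) (hA : ∀ i j, MemLp (fun ω => M.Ahat ω i j) 2 P) (u v w : Param p q) :
    ⟪infoL P M u v, w⟫
      = quarticHess imgL (M.mu • vecL) prodL u v w + ⟪penL M v, w⟫ := by
  have h1 : infoL P M u v = Matrix.toEuclideanLin (info P M u) v + penL M v := by
    change Matrix.toEuclideanLin (info P M u + penMat M) v = _
    rw [map_add]
    rfl
  rw [h1, inner_add_left, quarticHess_comm prodL_comm]
  congr 1
  have h2 := inner_toEuclideanLin_of_bilinear (B := info P M u)
    (-fderiv ℝ (fderiv ℝ (meanLogLik P M)) u) (fun i j => by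
      rw [info, iteratedFDeriv_two_apply]
      rfl) v w
  rw [h2, (meanLogLik_eq_quartic hZ hA).2, neg_apply, neg_apply,
    fderiv_fderiv_quartic_apply prodL_comm, neg_neg]

lemma infoL_invInfo {u : Param p q} (hinj : ∀ v, infoL P M u v = 0 → v = 0) (v : Param p q) :
    infoL P M u (invInfo P M u v) = v := by
  have hu : IsUnit (penInfo P M u) := by
    rw [← Matrix.mulVec_injective_iff_isUnit]
    intro x y hxy
    have h1 : infoL P M u (WithLp.toLp 2 x - WithLp.toLp 2 y) = 0 := by
      rw [map_sub, sub_eq_zero]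
      exact congrArg (WithLp.toLp 2) hxy
    exact WithLp.toLp_injective 2 (sub_eq_zero.1 (hinj _ h1))
  change Matrix.toEuclideanLin _ (Matrix.toEuclideanLin _ v) = v
  simp only [Matrix.toLpLin_apply, Matrix.mulVec_mulVec]
  rw [Matrix.mul_nonsing_inv _ ((Matrix.isUnit_iff_isUnit_det _).1 hu), Matrix.one_mulVec]

/-- The inverse of the penalized information matrix as a continuous linear map. -/
noncomputable def invInfoL (P : Measure Ω) (M : Model Ω p q) (u : Param p q) :
    Param p q →L[ℝ] Param p q :=
  LinearMap.toContinuousLinearMap (Matrix.toEuclideanLin (penInfo P M u)⁻¹)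

lemma tensor_eq [IsProbabilityMeasure P]
    (hZ : MemLp M.Z 2 P) (hA : ∀ i j, MemLp (fun ω => M.Ahat ω i j) 2 P) (u : Param p q) :
    tensor P M u = fun v => 1 / 6 * (2 * quarticThird imgL prodL u v v v) := by
  ext v
  rw [tensor, (meanLogLik_eq_quartic hZ hA).2, iteratedFDeriv_three_quartic prodL_comm]

end Model

end EiO

/-! ### Expansion of the estimators and the risk bounds -/

namespace EiO

section Main

open scoped RealInnerProductSpace

variable {Ω : Type*} [MeasurableSpace Ω] {P : Measure Ω} {p q : ℕ} {M : Model Ω p q}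
  {D : Matrix (Fin p) (Fin p) ℝ} {As : Matrix (Fin q) (Fin p) ℝ}

/-- The third-order expansion `y ≈ υG + F⁻¹ {A + ∇T(F⁻¹ A)}` of a maximizer `y` of the penalized
expected log-likelihood perturbed by the linear term `⟨A, ·⟩`, and the size of its correction. -/
lemma norm_expansion_le [IsProbabilityMeasure P] (hmu : 0 < M.mu) (hZ : MemLp M.Z 2 P)
    (hA : ∀ i j, MemLp (fun ω => M.Ahat ω i j) 2 P) (hD : D.PosDef) (hN : 0 < effN D)
    (hDl : ∀ s, ‖Matrix.toEuclideanLin As s‖ ≤ ‖Matrix.toEuclideanLin D s‖)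
    (hDu : ∀ s, ‖Matrix.toEuclideanLin D s‖ ^ 2
      ≤ ‖Matrix.toEuclideanLin As s‖ ^ 2 + ‖Matrix.toEuclideanLin M.G s‖ ^ 2)
    {υG y A : Param p q} (hυG : IsMaxOn (meanPenLogLik P M) Set.univ υG)
    {δ₀ : ℝ} (hδ : δ₀ ≤ 1 / 10)
    (hGU : υG ∈ localSet M D δ₀ As) (hyU : y ∈ localSet M D δ₀ As)
    (hy : ∀ v, quarticDeriv imgL (M.mu • vecL) prodL (meanZ P M) (meanA P M) y v
      = ⟪penL M y, v⟫ - ⟪A, v⟫)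
    (hρ : (scale M D)⁻¹ * ‖metricL M D (invInfo P M υG A)‖ ≤ 2 / 81) :
    ‖metricL M D (y - υG - invInfo P M υG (A + gradient (tensor P M υG) (invInfo P M υG A)))‖
        ≤ 330 * (scale M D)⁻¹ ^ 2 * ‖metricL M D (invInfo P M υG A)‖ ^ 3 ∧
      ‖metricL M D (invInfo P M υG (A + gradient (tensor P M υG) (invInfo P M υG A))
          - invInfo P M υG A)‖
        ≤ 9 * (scale M D)⁻¹ * ‖metricL M D (invInfo P M υG A)‖ ^ 2 := by
  have hG1 := localSet_subset_region (As := As) hmu hD hδ hGU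
  have hy1 := localSet_subset_region (As := As) hmu hD hδ hyU
  have hc₀ : 0 ≤ (scale M D)⁻¹ := inv_nonneg.2 (scale_pos hmu hN).le
  have hc : ∀ v, 1 / 4 * ‖metricL M D v‖ ^ 2 ≤ ⟪infoL P M υG v, v⟫ := fun v => by
    rw [inner_infoL hZ hA]
    exact coercive_quarticHess hmu hD hN hDl hDu (Or.inl ⟨rfl, rfl⟩) hG1 v
  have hinj : ∀ v, infoL P M υG v = 0 → v = 0 := fun v hv => by
    have h1 := hc v
    rw [hv, inner_zero_left] at h1
    refine metricL_eq_zero hmu hD (norm_eq_zero.1 ?_)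
    nlinarith [norm_nonneg (metricL M D v)]
  set b := invInfo P M υG A
  set φ := invInfo P M υG (A + gradient (tensor P M υG) b)
  have hb : infoL P M υG b = A := infoL_invInfo hinj A
  have hφ : ∀ v, ⟪infoL P M υG φ, v⟫ = ⟪A, v⟫ + quarticThird imgL prodL υG b b v := fun v => by
    rw [infoL_invInfo hinj, inner_add_left, tensor_eq hZ hA, inner_gradient_cubic prodL_comm]
  have hT := abs_quarticThird_le hmu hD hN hDl hG1
  refine ⟨?_, norm_correction_le hT hc hc₀ hb hφ⟩
  -- The segment from `υG + F⁻¹ A` to `y` stays in the region of radius `1 / 8 ≥ 1 / 10 + 2 / 81`.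
  have hmono : ∀ {δ δ' : ℝ} {z : Param p q}, δ ≤ δ' → z ∈ region M D As δ →
      z ∈ region M D As δ' := fun hδ' ⟨h1, h2, h3⟩ =>
    have hk := mul_le_mul_of_nonneg_right hδ' (scale_pos hmu hN).le
    ⟨h1.trans hk, h2.trans hk, fun s => (h3 s).trans
      (mul_le_mul_of_nonneg_right hδ' (norm_nonneg _))⟩
  have hb8 : υG + b ∈ region M D As (1 / 8) :=
    hmono (by norm_num) (region_add hmu hD hN hG1 hρ)
  have hy8 : y ∈ region M D As (1 / 8) := hmono (by norm_num) hy1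
  refine norm_sub_expansion_le (σ := M.mu • vecL) (h := meanZ P M) (a := meanA P M)
    (pen := penL M) (u₀ := υG) prodL_comm hc₀ (norm_prodL_le hmu hD hN) hT
    (inner_infoL hZ hA υG) (quarticDeriv_of_isMaxOn_meanPenLogLik hZ hA hυG) ?_ hb hφ hc ?_ hρ
  · rw [add_sub_cancel]
    exact hy
  · intro t ht v
    refine coercive_quarticHess hmu hD hN hDl hDu (Or.inr ⟨rfl, rfl⟩) ?_ v
    rw [show y - υG - b = y - (υG + b) by abel]
    refine region_segment hb8 hy8 ?_
    rcases ht with rfl | rfl | rfl <;> norm_num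

lemma sq_bounds_of_abs_sqrt_sub_le {a b α : ℝ} (ha : 0 ≤ a) (hb : 0 ≤ b) (hα : α < 1)
    (h : |Real.sqrt a - Real.sqrt b| ≤ α * Real.sqrt b) :
    (1 - α) ^ 2 * b ≤ a ∧ a ≤ (1 + α) ^ 2 * b := by
  obtain ⟨h1, h2⟩ := abs_le.1 h
  have h3 : 0 ≤ (1 - α) * Real.sqrt b := mul_nonneg (by linarith) (Real.sqrt_nonneg b)
  have h4 : (1 - α) * Real.sqrt b ≤ Real.sqrt a := by linarith
  have h5 : Real.sqrt a ≤ (1 + α) * Real.sqrt b := by linarith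
  have h6 := pow_le_pow_left₀ h3 h4 2
  have h7 := pow_le_pow_left₀ (Real.sqrt_nonneg a) h5 2
  rw [mul_pow, Real.sq_sqrt ha, Real.sq_sqrt hb] at h6 h7
  exact ⟨h6, h7⟩

lemma memLp_of_norm_sub_le {V : Type*} [NormedAddCommGroup V] {ν : Measure Ω} [IsFiniteMeasure ν]
    {f g : Ω → V} (hg : MemLp g 2 ν) (hf : AEStronglyMeasurable f ν) {C : ℝ}
    (h : ∀ᵐ ω ∂ν, ‖f ω - g ω‖ ≤ C) : MemLp f 2 ν := by
  have h1 : MemLp (f - g) 2 ν := MemLp.of_bound (hf.sub hg.1) C h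
  simpa using h1.add hg

lemma aestronglyMeasurable_phi [IsProbabilityMeasure P] (hZ : MemLp M.Z 2 P)
    (hA : ∀ i j, MemLp (fun ω => M.Ahat ω i j) 2 P) (u : Param p q) :
    AEStronglyMeasurable (phi P M u) P := by
  have hs := (memLp_score hZ hA u).1.1
  have h1 : Continuous (fun v =>
      invInfoL P M u (v + gradient (tensor P M u) (invInfoL P M u v))) := by
    rw [tensor_eq hZ hA]
    exact (invInfoL P M u).continuous.comp
      (continuous_id.add ((continuous_gradient_cubic u).comp (invInfoL P M u).continuous))
  exact h1.comp_aestronglyMeasurable hs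

end Main

end EiO

theorem mainTheorem3 {Ω : Type*} [MeasurableSpace Ω] (P : Measure Ω) [IsProbabilityMeasure P]
    {p q m : ℕ} (M : EiO.Model Ω p q) (hmu : 0 < M.mu)
    (hZ : MemLp M.Z 2 P) (hA : ∀ i j, MemLp (fun ω => M.Ahat ω i j) 2 P)
    -- the truth, the population counterpart of the estimator, and the penalized MLE
    (υs υG : EiO.Param p q) (υt : Ω → EiO.Param p q)
    (hυs : IsMaxOn (EiO.meanLogLik P M) Set.univ υs)
    (hυG : IsMaxOn (EiO.meanPenLogLik P M) Set.univ υG)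
    (hυt : AEMeasurable υt P)
    -- the matrix `D` and the local set
    (D : Matrix (Fin p) (Fin p) ℝ) (hD : D.PosDef)
    (hDl : (D * D - (EiO.opr υs).transpose * EiO.opr υs).PosSemidef)
    (hDu : ((EiO.opr υs).transpose * EiO.opr υs + M.G.transpose * M.G - D * D).PosSemidef)
    (δ₀ : ℝ) (hδ : 0 < δ₀) (hδ' : δ₀ ≤ 1 / 10)
    (hsU : υs ∈ EiO.localSet M D δ₀ (EiO.opr υs))
    (hGU : υG ∈ EiO.localSet M D δ₀ (EiO.opr υs))
    -- the random set of high probability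
    (x : ℝ) (hx : 0 < x) (Ωx : Set Ω) (hΩx : MeasurableSet Ωx)
    (hPΩx : 1 - 3 * Real.exp (-x) ≤ P.real Ωx)
    (hr : ∀ ω ∈ Ωx, ‖EiO.normStoch P M D υG ω‖ ≤ EiO.rD P M D υG x)
    (hmax : ∀ ω ∈ Ωx, IsMaxOn (EiO.penLogLik M ω) Set.univ (υt ω) ∧
      υt ω ∈ EiO.localSet M D δ₀ (EiO.opr υs))
    -- the critical dimension conditions
    (hR : 3 / 2 * max (EiO.rD P M D υG x) (EiO.bD P M D υG υs) ≤ EiO.radius M D δ₀)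
    (h3 : EiO.kap ^ 2 * EiO.tau3 M D
      * max (EiO.rD P M D υG x) (EiO.bD P M D υG υs) < 4 / 9)
    (h4 : EiO.kap ^ 2 * EiO.tau4 M D
      * max (EiO.rD P M D υG x) (EiO.bD P M D υG υs) ^ 2 < 1 / 3)
    -- the moment conditions
    (C₃ C₄ C₆ : ℝ) (hC₃ : 0 ≤ C₃) (hC₄ : 0 ≤ C₄) (hC₆ : 0 ≤ C₆)
    (hm3 : ∫ ω in Ωx, ‖EiO.normStoch P M D υG ω‖ ^ 3 ∂P
      ≤ C₃ ^ 2 * EiO.effDim P M D υG ^ (3 / 2 : ℝ))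
    (hm4 : ∫ ω in Ωx, ‖EiO.normStoch P M D υG ω‖ ^ 4 ∂P
      ≤ C₄ ^ 2 * EiO.effDim P M D υG ^ 2)
    (hm6 : ∫ ω in Ωx, ‖EiO.normStoch P M D υG ω‖ ^ 6 ∂P
      ≤ C₆ ^ 2 * EiO.effDim P M D υG ^ 3)
    -- any linear mapping of the target
    (Q : EuclideanSpace ℝ (Fin p) →L[ℝ] EuclideanSpace ℝ (Fin m)) :
    -- all the expectations below are finite
    (MemLp (fun ω => Q (EiO.src (υt ω) - EiO.src υs)) 2 (P.restrict Ωx) ∧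
      MemLp (fun ω => Q (EiO.src (EiO.phi P M υG ω) - EiO.src (EiO.muVec P M υG υs))) 2
        (P.restrict Ωx) ∧
      MemLp (fun ω => Q (EiO.src (EiO.stoch P M υG ω) - EiO.src (EiO.bias P M υG υs))) 2
        (P.restrict Ωx)) ∧
    -- the bound on the mean loss
    (∫ ω in Ωx, ‖Q (EiO.src (υt ω) - EiO.src υs)‖ ∂P
      ≤ ∫ ω in Ωx, ‖Q (EiO.src (EiO.phi P M υG ω) - EiO.src (EiO.muVec P M υG υs))‖ ∂P
        + EiO.normQD Q D * EiO.kap ^ 2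
          * (EiO.tau4 M D / 2 + EiO.kap ^ 2 * EiO.tau3 M D ^ 2)
          * (C₃ ^ 2 * EiO.effDim P M D υG ^ (3 / 2 : ℝ) + EiO.bD P M D υG υs ^ 3)) ∧
    -- comparison of the leading terms in mean
    (|∫ ω in Ωx, ‖Q (EiO.src (EiO.phi P M υG ω) - EiO.src (EiO.muVec P M υG υs))‖ ∂P
        - ∫ ω in Ωx, ‖Q (EiO.src (EiO.stoch P M υG ω) - EiO.src (EiO.bias P M υG υs))‖ ∂P|
      ≤ EiO.normQD Q D * (EiO.kap ^ 2 * EiO.tau3 M D / 2)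
        * (EiO.effDim P M D υG + EiO.bD P M D υG υs ^ 2)) ∧
    -- two-sided bound on the squared risk
    (0 < EiO.riskQ2 P M Q υG υs Ωx → EiO.alphaQ2 P M D Q υG υs Ωx C₆ < 1 →
      (1 - EiO.alphaQ2 P M D Q υG υs Ωx C₆) ^ 2 * EiO.riskQ2 P M Q υG υs Ωx
          ≤ ∫ ω in Ωx, ‖Q (EiO.src (υt ω) - EiO.src υs)‖ ^ 2 ∂P ∧
        ∫ ω in Ωx, ‖Q (EiO.src (υt ω) - EiO.src υs)‖ ^ 2 ∂P
          ≤ (1 + EiO.alphaQ2 P M D Q υG υs Ωx C₆) ^ 2 * EiO.riskQ2 P M Q υG υs Ωx) ∧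
    -- comparison of the two risks
    (∀ α₁ : ℝ, α₁ < 1 →
      EiO.normQD Q D * (EiO.kap ^ 2 * EiO.tau3 M D / 2)
          * (C₄ * EiO.effDim P M D υG + EiO.bD P M D υG υs ^ 2)
        ≤ α₁ * Real.sqrt (EiO.riskQ P M Q υG υs Ωx) →
      EiO.riskQ P M Q υG υs Ωx * (1 - α₁) ^ 2 ≤ EiO.riskQ2 P M Q υG υs Ωx ∧
        EiO.riskQ2 P M Q υG υs Ωx ≤ EiO.riskQ P M Q υG υs Ωx * (1 + α₁) ^ 2) := by
  have hDl' := EiO.norm_toEuclideanLin_le_of_posSemidef hD hDl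
  have hDu' := EiO.norm_sq_le_of_posSemidef_add hD hDu
  rcases Nat.eq_zero_or_pos p with rfl | hp
  · -- Without source coordinates every loss vanishes, and so does the norm of `Q`.
    have hQ : ∀ v, Q v = 0 := fun v => by rw [Subsingleton.elim v 0, map_zero]
    have hQD : EiO.normQD Q D = 0 := by
      rw [EiO.normQD, norm_eq_zero]
      ext1 v
      exact hQ _
    simp [hQ, hQD, EiO.riskQ, EiO.riskQ2]
  have : Nonempty (Fin p) := ⟨⟨0, hp⟩⟩
  have hN := EiO.effN_pos hD
  have hk := EiO.scale_pos hmu hN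
  set c₀ := (EiO.scale M D)⁻¹ with hc₀def
  have hc₀ : 0 < c₀ := inv_pos.2 hk
  set r := EiO.rD P M D υG x
  set b := EiO.bD P M D υG υs with hbdef
  have hb0 : 0 ≤ b := norm_nonneg _
  rw [EiO.tau3_eq, EiO.kap] at h3
  have hρ : ∀ t, t ≤ max r b → c₀ * t ≤ 2 / 81 := fun t ht => by
    have := mul_le_mul_of_nonneg_left ht hc₀.le
    linarith
  have hnQ : 0 ≤ EiO.normQD Q D := norm_nonneg _
  -- The expansion of the population counterpart: `υs` maximizes the penalized criterion with the
  -- linear term `⟨G² υs, ·⟩` added.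
  obtain ⟨eb1, eb2⟩ := EiO.norm_expansion_le hmu hZ hA hD hN hDl' hDu' hυG hδ' hGU hsU
    (A := EiO.penL M υs) (fun v => by
      rw [EiO.quarticDeriv_of_isMaxOn_meanLogLik hZ hA hυs, sub_self])
    (hρ _ (le_max_right r b))
  change ‖EiO.metricL M D (υs - υG - EiO.muVec P M υG υs)‖ ≤ 330 * c₀ ^ 2 * b ^ 3 at eb1
  change ‖EiO.metricL M D (EiO.muVec P M υG υs - EiO.bias P M υG υs)‖ ≤ 9 * c₀ * b ^ 2 at eb2
  have es : ∀ ω ∈ Ωx,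
      ‖EiO.metricL M D (υt ω - υG - EiO.phi P M υG ω)‖
        ≤ 330 * c₀ ^ 2 * ‖EiO.normStoch P M D υG ω‖ ^ 3 ∧
      ‖EiO.metricL M D (EiO.phi P M υG ω - EiO.stoch P M υG ω)‖
        ≤ 9 * c₀ * ‖EiO.normStoch P M D υG ω‖ ^ 2 := fun ω hω =>
    EiO.norm_expansion_le hmu hZ hA hD hN hDl' hDu' hυG hδ' hGU (hmax ω hω).2
      (A := EiO.score P M υG ω) (fun v => by
        have h1 := EiO.quarticDeriv_data_eq hZ hA (υt ω) υG v ω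
        rw [EiO.quarticDeriv_of_isMaxOn_penLogLik (hmax ω hω).1] at h1
        linarith)
      (hρ _ ((hr ω hω).trans (le_max_left r b)))
  -- The two pointwise comparisons on `Ωx`.
  have d1 : ∀ ω ∈ Ωx, ‖Q (EiO.src (υt ω) - EiO.src υs)
      - Q (EiO.src (EiO.phi P M υG ω) - EiO.src (EiO.muVec P M υG υs))‖
      ≤ EiO.normQD Q D * (330 * c₀ ^ 2) * (‖EiO.normStoch P M D υG ω‖ ^ 3 + b ^ 3) := by
    intro ω hω
    have h1 := EiO.norm_map_src_le (M := M) hD Q ((υt ω - υG - EiO.phi P M υG ω)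
      - (υs - υG - EiO.muVec P M υG υs))
    have h2 := norm_sub_le (EiO.metricL M D (υt ω - υG - EiO.phi P M υG ω))
      (EiO.metricL M D (υs - υG - EiO.muVec P M υG υs))
    rw [← map_sub] at h2
    have h3 := h2.trans (add_le_add (es ω hω).1 eb1)
    have h4 := h1.trans (mul_le_mul_of_nonneg_left h3 hnQ)
    rw [← map_sub]
    have e : EiO.src (υt ω) - EiO.src υs
        - (EiO.src (EiO.phi P M υG ω) - EiO.src (EiO.muVec P M υG υs))
        = EiO.src ((υt ω - υG - EiO.phi P M υG ω) - (υs - υG - EiO.muVec P M υG υs)) := by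
      simp only [EiO.src_sub]
      abel
    rw [e]
    linarith
  have d2 : ∀ ω ∈ Ωx, ‖Q (EiO.src (EiO.phi P M υG ω) - EiO.src (EiO.muVec P M υG υs))
      - Q (EiO.src (EiO.stoch P M υG ω) - EiO.src (EiO.bias P M υG υs))‖
      ≤ EiO.normQD Q D * (9 * c₀) * (‖EiO.normStoch P M D υG ω‖ ^ 2 + b ^ 2) := by
    intro ω hω
    have h1 := EiO.norm_map_src_le (M := M) hD Q ((EiO.phi P M υG ω - EiO.stoch P M υG ω)
      - (EiO.muVec P M υG υs - EiO.bias P M υG υs))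
    have h2 := norm_sub_le (EiO.metricL M D (EiO.phi P M υG ω - EiO.stoch P M υG ω))
      (EiO.metricL M D (EiO.muVec P M υG υs - EiO.bias P M υG υs))
    rw [← map_sub] at h2
    have h3 := h2.trans (add_le_add (es ω hω).2 eb2)
    have h4 := h1.trans (mul_le_mul_of_nonneg_left h3 hnQ)
    rw [← map_sub]
    have e : EiO.src (EiO.phi P M υG ω) - EiO.src (EiO.muVec P M υG υs)
        - (EiO.src (EiO.stoch P M υG ω) - EiO.src (EiO.bias P M υG υs))
        = EiO.src ((EiO.phi P M υG ω - EiO.stoch P M υG ω)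
          - (EiO.muVec P M υG υs - EiO.bias P M υG υs)) := by
      simp only [EiO.src_sub]
      abel
    rw [e]
    linarith
  -- Moments of the score.
  obtain ⟨hs2, hs0⟩ := EiO.memLp_score hZ hA υG
  have hst2 : MemLp (EiO.stoch P M υG) 2 P := (EiO.invInfoL P M υG).comp_memLp' hs2
  have hns2 : MemLp (EiO.normStoch P M D υG) 2 P := (EiO.metricL M D).comp_memLp' hst2
  have hns0 : ∫ ω, EiO.normStoch P M D υG ω ∂P = 0 := by
    have h1 := ((EiO.metricL M D).comp (EiO.invInfoL P M υG)).integral_comp_comm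
      (hs2.integrable (by norm_num))
    rw [hs0, map_zero] at h1
    exact h1
  have hdim : ∫ ω, ‖EiO.normStoch P M D υG ω‖ ^ 2 ∂P = EiO.effDim P M D υG :=
    EiO.integral_norm_sq_eq_trace_varMat hns2 hns0
  have hdim0 : 0 ≤ EiO.effDim P M D υG := by
    rw [← hdim]
    exact integral_nonneg fun ω => sq_nonneg _
  have hm2 : ∫ ω in Ωx, ‖EiO.normStoch P M D υG ω‖ ^ 2 ∂P ≤ EiO.effDim P M D υG := by
    rw [← hdim]
    exact setIntegral_le_integral (hns2.integrable_norm_pow (by norm_num))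
      (Filter.Eventually.of_forall fun ω => sq_nonneg _)
  have hY : AEStronglyMeasurable (fun ω => ‖EiO.normStoch P M D υG ω‖) (P.restrict Ωx) :=
    hns2.1.norm.restrict
  have hYr : ∀ᵐ ω ∂P.restrict Ωx, ‖‖EiO.normStoch P M D υG ω‖‖ ≤ r := by
    filter_upwards [ae_restrict_mem hΩx] with ω hω
    rw [norm_norm]
    exact hr ω hω
  have hd1 := (ae_restrict_mem (μ := P) hΩx).mono d1
  have hd2 := (ae_restrict_mem (μ := P) hΩx).mono d2
  have hν : (P.restrict Ωx).real Set.univ ≤ 1 := by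
    rw [measureReal_restrict_apply_univ]
    exact measureReal_le_one
  have hk1 : 0 ≤ EiO.normQD Q D * (330 * c₀ ^ 2) := by positivity
  have hk2 : 0 ≤ EiO.normQD Q D * (9 * c₀) := by positivity
  -- Finiteness of the risks.
  have m3 : MemLp (fun ω => Q (EiO.src (EiO.stoch P M υG ω) - EiO.src (EiO.bias P M υG υs))) 2
      (P.restrict Ωx) :=
    ((Q.comp EiO.srcL).comp_memLp' (hst2.sub (memLp_const (EiO.bias P M υG υs)))).restrict Ωx
  have m2 : MemLp (fun ω => Q (EiO.src (EiO.phi P M υG ω) - EiO.src (EiO.muVec P M υG υs))) 2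
      (P.restrict Ωx) := by
    refine EiO.memLp_of_norm_sub_le (C := EiO.normQD Q D * (9 * c₀) * (r ^ 2 + b ^ 2)) m3 ?_ ?_
    · exact ((Q.comp EiO.srcL).continuous.comp_aestronglyMeasurable
        ((EiO.aestronglyMeasurable_phi hZ hA υG).sub
          (aestronglyMeasurable_const (b := EiO.muVec P M υG υs)))).restrict
    · filter_upwards [ae_restrict_mem hΩx] with ω hω
      exact (d2 ω hω).trans (mul_le_mul_of_nonneg_left
        (add_le_add_left (pow_le_pow_left₀ (norm_nonneg _) (hr ω hω) 2) _) hk2)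
  have m1 : MemLp (fun ω => Q (EiO.src (υt ω) - EiO.src υs)) 2 (P.restrict Ωx) := by
    refine EiO.memLp_of_norm_sub_le
      (C := EiO.normQD Q D * (330 * c₀ ^ 2) * (r ^ 3 + b ^ 3)) m2 ?_ ?_
    · exact ((Q.comp EiO.srcL).continuous.comp_aestronglyMeasurable
        (hυt.aestronglyMeasurable.sub (aestronglyMeasurable_const (b := υs)))).restrict
    · filter_upwards [ae_restrict_mem hΩx] with ω hω
      exact (d1 ω hω).trans (mul_le_mul_of_nonneg_left
        (add_le_add_left (pow_le_pow_left₀ (norm_nonneg _) (hr ω hω) 3) _) hk1)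
  have hK1 : EiO.normQD Q D * EiO.kap ^ 2 * (EiO.tau4 M D / 2 + EiO.kap ^ 2 * EiO.tau3 M D ^ 2)
      = EiO.normQD Q D * (330 * c₀ ^ 2) := by
    rw [EiO.tau3_eq, EiO.tau4_eq hN.le, EiO.kap]
    ring
  have hK2 : EiO.normQD Q D * (EiO.kap ^ 2 * EiO.tau3 M D / 2) = EiO.normQD Q D * (9 * c₀) := by
    rw [EiO.tau3_eq, EiO.kap]
    ring
  refine ⟨⟨m1, m2, m3⟩, ?_, ?_, fun hpos hα => ?_, fun α₁ hα₁ hle => ?_⟩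
  · have h1 := EiO.abs_integral_norm_sub_le hν m1 m2 hY hYr hk1 hb0 hd1 hm3
    rw [hK1]
    linarith [(abs_le.1 h1).2]
  · rw [hK2]
    exact EiO.abs_integral_norm_sub_le hν m2 m3 hY hYr hk2 hb0 hd2 hm2
  · have hS : 0 ≤ C₆ * EiO.effDim P M D υG ^ (3 / 2 : ℝ) :=
      mul_nonneg hC₆ (Real.rpow_nonneg hdim0 _)
    have h1 := EiO.abs_sqrt_integral_sub_le hν m1 m2 hY hYr hk1 hb0 hS hd1 (by
      rw [mul_pow, ← Real.rpow_mul_natCast hdim0]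
      norm_num
      exact hm6)
    refine EiO.sq_bounds_of_abs_sqrt_sub_le (integral_nonneg fun ω => sq_nonneg _) hpos.le hα ?_
    rw [EiO.alphaQ2, div_mul_cancel₀ _ (Real.sqrt_pos.2 hpos).ne', hK1]
    exact h1
  · have hS : 0 ≤ C₄ * EiO.effDim P M D υG := mul_nonneg hC₄ hdim0
    have h1 := EiO.abs_sqrt_integral_sub_le hν m2 m3 hY hYr hk2 hb0 hS hd2 (by
      rw [mul_pow]
      exact hm4)
    have e : EiO.riskQ P M Q υG υs Ωx = ∫ ω in Ωx,
        ‖Q (EiO.src (EiO.stoch P M υG ω) - EiO.src (EiO.bias P M υG υs))‖ ^ 2 ∂P := by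
      simp only [EiO.riskQ, map_sub]
    rw [hK2] at hle
    have h2 := EiO.sq_bounds_of_abs_sqrt_sub_le (a := EiO.riskQ2 P M Q υG υs Ωx)
      (b := EiO.riskQ P M Q υG υs Ωx) (integral_nonneg fun ω => sq_nonneg _)
      (integral_nonneg fun ω => sq_nonneg _) hα₁ (by
        refine le_trans ?_ hle
        rw [e]
        exact h1)
    rw [mul_comm _ ((1 - α₁) ^ 2), mul_comm _ ((1 + α₁) ^ 2)]
    exact h2
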